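/- Let $\mathbb K$ be a field of characteristic zero, let $\mathcal O$ be a commutative unital $\mathbb K$-algebra, and let $(\mathcal A,[\cdot,\cdot]_{\mathcal A},\rho_{\mathcal A})$ be a Lie-Rinehart algebra over $\mathcal O$: an $\mathcal O$-module with a $\mathbb K$-Lie bracket and an $\mathcal O$-linear Lie algebra morphism $\rho_{\mathcal A}:\mathcal A\to\mathrm{Der}_{\mathbb K}(\mathcal O)$ such that $[a,fb]_{\mathcal A}=\rho_{\mathcal A}(a)[f]\,b+f[a,b]_{\mathcal A}$ for all $a,b\in\mathcal A$, $f\in\mathcal O$. A (negatively graded) Lie $\infty$-algebroid over $\mathcal O$ is a family $\mathcal E=(\mathcal E_{-i})_{i\ge1}$ of projective $\mathcal O$-modules with graded symmetric $\mathbb K$-multilinear brackets $\ell_k$ ($k\ge1$) of degree $+1$ on $\bigoplus_i\mathcal E_{-i}$, where $\ell_k$ takes $k$ arguments, and an $\mathcal O$-linear anchor $\rho:\mathcal E_{-1}\to\mathrm{Der}_{\mathbb K}(\mathcal O)$, extended by zero to $\mathcal E_{-i}$ for $i\ge2$, such that: (i) for all $n\ge1$ and homogeneous $x_1,\dots,x_n\in\mathcal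 E$, $$\sum_{i=1}^{n}\sum_{\sigma\in\mathfrak S(i,n-i)}\epsilon(\sigma)\,\ell_{n-i+1}\big(\ell_i(x_{\sigma(1)},\dots,x_{\sigma(i)}),x_{\sigma(i+1)},\dots,x_{\sigma(n)}\big)=0,$$ where $\mathfrak S(i,n-i)$ is the set of $(i,n-i)$-shuffles and $\epsilon(\sigma)$ is the Koszul sign; (ii) $\ell_k$ is $\mathcal O$-multilinear for $k\neq2$, and $\ell_2(x,fy)=\rho(x)[f]\,y+f\,\ell_2(x,y)$; (iii) $\rho\circ\ell_1=0$ on $\mathcal E_{-2}$; (iv) $\rho(\ell_2(x,y))=[\rho(x),\rho(y)]$ for $x,y\in\mathcal E_{-1}$. It is acyclic if the complex $(\mathcal E,\ell_1)$ has no cohomology in degrees $\le-2$. It covers $\mathcal A$ through an $\mathcal O$-linear map $\pi:\mathcal E_{-1}\to\mathcal A$ if $\pi$ is surjective, $\rho_{\mathcal A}\circ\pi=\rho$, and $\pi(\ell_2(x,y))=[\pi(x),\pi(y)]_{\mathcal A}$ for all $x,y\in\mathcal E_{-1}$. Its basic Lie-Rinehart algebra is $\mathcal E_{-1}/\ell_1(\mathcal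 E_{-2})$ with the bracket and the anchor induced by $\ell_2$ and $\rho$. **Theorem.** Let $$\cdots\xrightarrow{\ \mathrm d\ }\mathcal E_{-3}\xrightarrow{\ \mathrm d\ }\mathcal E_{-2}\xrightarrow{\ \mathrm d\ }\mathcal E_{-1}\xrightarrow{\ \pi\ }\mathcal A\longrightarrow0$$ be any resolution of the $\mathcal O$-module $\mathcal A$ by free $\mathcal O$-modules, of any finite or infinite length and with terms of any finite or infinite rank. Then $\mathcal E=(\mathcal E_{-i})_{i\ge1}$ carries a Lie $\infty$-algebroid structure whose unary bracket is $\ell_1=\mathrm d$ and which covers $\mathcal A$ through $\pi$. **Corollary.** Every Lie-Rinehart algebra $\mathcal A$ over $\mathcal O$ is isomorphic, as a Lie-Rinehart algebra over $\mathcal O$, to the basic Lie-Rinehart algebra of an acyclic Lie $\infty$-algebroid over $\mathcal O$. -/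

import Mathlib

open scoped DirectSum LieRinehartAlgebra

universe uK uO uA uE

/-- A complex `⋯ → E₂ → E₁ → E₀ → A → 0` of `O`-modules that is exact everywhere and whose terms
`E n` are free (of any rank; a finite resolution has `E n = 0` for large `n`).
The module `E n` sits in degree `-(n + 1)`. -/
structure FreeResolution (O : Type uO) (A : Type uA) (E : ℕ → Type uE)
    [CommRing O] [AddCommGroup A] [Module O A]
    [∀ n, AddCommGroup (E n)] [∀ n, Module O (E n)] where
  free : ∀ n, Module.Free O (E n)
  /-- The differential `𝓔₋ₙ₋₂ → 𝓔₋ₙ₋₁`. -/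
  d : ∀ n, E (n + 1) →ₗ[O] E n
  /-- The augmentation `𝓔₋₁ → A`. -/
  aug : E 0 →ₗ[O] A
  exact_d : ∀ n, Function.Exact (d (n + 1)) (d n)
  exact_aug : Function.Exact (d 0) aug
  aug_surjective : Function.Surjective aug

/-- For a family `E` with `E n` placed in degree `-(n + 1)`, the homogeneous elements of degree `m`
of the total space `⨁ n, E n` (only zero if `m` is not one of the degrees `-1, -2, …`). -/
def IsHomogeneousOfDegree {E : ℕ → Type uE} [∀ n, AddCommGroup (E n)]
    (m : ℤ) (x : ⨁ n, E n) : Prop :=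
  ∀ n : ℕ, -((n : ℤ) + 1) ≠ m → x n = 0

/-- The Koszul sign `ε(σ; x₁, …, x_k)` for homogeneous elements of degrees `deg`: the product of
`(-1)^{|x_{σ(i)}| |x_{σ(j)}|}` over the inversions `i < j`, `σ(j) < σ(i)`. Thus
`x_{σ(1)} ⊙ ⋯ ⊙ x_{σ(k)} = ε(σ) x₁ ⊙ ⋯ ⊙ x_k`. -/
def koszulSign {k : ℕ} (deg : Fin k → ℤ) (σ : Equiv.Perm (Fin k)) : ℤˣ :=
  ∏ p : Fin k × Fin k with p.1 < p.2 ∧ σ p.2 < σ p.1,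
    Int.negOnePow (deg (σ p.1) * deg (σ p.2))

/-- The `(p, n - p)`-shuffles: permutations increasing on the first `p` positions and on the
remaining `n - p` positions. -/
def shuffles (p n : ℕ) : Finset (Equiv.Perm (Fin n)) :=
  {σ : Equiv.Perm (Fin n) | ∀ a b : Fin n, a < b → ((b : ℕ) < p ∨ p ≤ (a : ℕ)) → σ a < σ b}

/-- A negatively graded Lie `∞`-algebroid structure over the commutative `K`-algebra `O` on the
family of `O`-modules `E`, where `E n` is in degree `-(n + 1)`. -/
structure LieInftyAlgebroid (K : Type uK) (O : Type uO) (E : ℕ → Type uE)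
    [Field K] [CommRing O] [Algebra K O]
    [∀ n, AddCommGroup (E n)] [∀ n, Module O (E n)]
    [∀ n, Module K (E n)] [∀ n, IsScalarTower K O (E n)] where
  projective : ∀ n, Module.Projective O (E n)
  /-- `bracket k` is the `(k + 1)`-ary bracket `ℓ_{k+1}`, a `K`-multilinear operation. -/
  bracket : ∀ k : ℕ, MultilinearMap K (fun _ : Fin (k + 1) => ⨁ n, E n) (⨁ n, E n)
  /-- The brackets are graded symmetric. -/
  bracket_perm : ∀ (k : ℕ) (deg : Fin (k + 1) → ℤ) (x : Fin (k + 1) → ⨁ n, E n),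
    (∀ i, IsHomogeneousOfDegree (deg i) (x i)) → ∀ σ : Equiv.Perm (Fin (k + 1)),
      bracket k (fun i => x (σ i)) = koszulSign deg σ • bracket k x
  /-- The brackets have degree `+1`. -/
  bracket_degree : ∀ (k : ℕ) (deg : Fin (k + 1) → ℤ) (x : Fin (k + 1) → ⨁ n, E n),
    (∀ i, IsHomogeneousOfDegree (deg i) (x i)) →
      IsHomogeneousOfDegree ((∑ i, deg i) + 1) (bracket k x)
  /-- The anchor map. -/
  anchor : E 0 →ₗ[O] Derivation K O O
  /-- The higher Jacobi identity for the `n + 1` homogeneous elements `x 0, …, x n`; the summand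
  with index `i` has the `(i + 1)`-ary bracket inside the `(n - i + 1)`-ary one. -/
  jacobi : ∀ (n : ℕ) (deg : Fin (n + 1) → ℤ) (x : Fin (n + 1) → ⨁ n, E n),
    (∀ i, IsHomogeneousOfDegree (deg i) (x i)) →
      ∑ i : Fin (n + 1), ∑ σ ∈ shuffles (i + 1) (n + 1),
        koszulSign deg σ •
          bracket (n - i)
            (Fin.cons
              (bracket i (fun a : Fin (i + 1) => x (σ ⟨a, by omega⟩)))
              (fun b : Fin (n - i) => x (σ ⟨i + 1 + b, by omega⟩))) = 0
  /-- All brackets except the binary one are `O`-multilinear. -/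
  bracket_smul : ∀ k : ℕ, k ≠ 1 → ∀ (x : Fin (k + 1) → ⨁ n, E n) (i : Fin (k + 1)) (f : O),
    bracket k (Function.update x i (f • x i)) = f • bracket k x
  /-- The Leibniz identity, with the anchor extended by zero to degrees `≤ -2`. -/
  leibniz : ∀ (x y : ⨁ n, E n) (f : O),
    bracket 1 ![x, f • y] = anchor (x 0) f • y + f • bracket 1 ![x, y]
  anchor_unary : ∀ z : E 1, anchor (bracket 0 ![DirectSum.of E 1 z] 0) = 0
  anchor_binary : ∀ x y : E 0,
    anchor (bracket 1 ![DirectSum.of E 0 x, DirectSum.of E 0 y] 0) = ⁅anchor x, anchor y⁆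

namespace LieInftyAlgebroid

section

variable {K : Type uK} {O : Type uO} {E : ℕ → Type uE}
  [Field K] [CommRing O] [Algebra K O]
  [∀ n, AddCommGroup (E n)] [∀ n, Module O (E n)]
  [∀ n, Module K (E n)] [∀ n, IsScalarTower K O (E n)]
  (L : LieInftyAlgebroid K O E)

lemma update_singleton {M : Type*} (a b : M) :
    Function.update (![a] : Fin (0 + 1) → M) 0 b = ![b] := by
  funext i
  fin_cases i
  rfl

lemma update_pair_zero {M : Type*} (a b c : M) :
    Function.update (![a, b] : Fin (1 + 1) → M) 0 c = ![c, b] := by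
  funext i
  fin_cases i <;> rfl

lemma update_pair_one {M : Type*} (a b c : M) :
    Function.update (![a, b] : Fin (1 + 1) → M) 1 c = ![a, c] := by
  funext i
  fin_cases i <;> rfl

/-- The unary bracket `ℓ₁ : 𝓔₋ₙ₋₂ → 𝓔₋ₙ₋₁`. -/
def diff (n : ℕ) : E (n + 1) →ₗ[O] E n where
  toFun x := L.bracket 0 ![DirectSum.of E (n + 1) x] n
  map_add' x y := by
    have h := (L.bracket 0).map_update_add ![0] 0
      (DirectSum.of E (n + 1) x) (DirectSum.of E (n + 1) y)
    rw [update_singleton, update_singleton, update_singleton] at h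
    rw [map_add, h, DirectSum.add_apply]
  map_smul' f x := by
    have h := L.bracket_smul 0 (by norm_num) ![DirectSum.of E (n + 1) x] 0 f
    rw [show (![DirectSum.of E (n + 1) x] : Fin (0 + 1) → _) 0 = DirectSum.of E (n + 1) x from rfl,
      update_singleton] at h
    rw [← DirectSum.lof_eq_of O, map_smul, DirectSum.lof_eq_of, h, DirectSum.smul_apply]
    rfl

/-- No cohomology in degrees `≤ -2`. -/
def IsAcyclic : Prop := ∀ n, Function.Exact (L.diff (n + 1)) (L.diff n)

/-- The binary bracket restricted to `𝓔₋₁`, where it takes values in `𝓔₋₁`. -/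
def binary (x y : E 0) : E 0 :=
  L.bracket 1 ![DirectSum.of E 0 x, DirectSum.of E 0 y] 0

lemma binary_add_left (x x' y : E 0) : L.binary (x + x') y = L.binary x y + L.binary x' y := by
  have h := (L.bracket 1).map_update_add ![0, DirectSum.of E 0 y] 0
    (DirectSum.of E 0 x) (DirectSum.of E 0 x')
  rw [update_pair_zero, update_pair_zero, update_pair_zero] at h
  simp only [binary, map_add, h, DirectSum.add_apply]

lemma binary_add_right (x y y' : E 0) : L.binary x (y + y') = L.binary x y + L.binary x y' := by
  have h := (L.bracket 1).map_update_add ![DirectSum.of E 0 x, 0] 1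
    (DirectSum.of E 0 y) (DirectSum.of E 0 y')
  rw [update_pair_one, update_pair_one, update_pair_one] at h
  simp only [binary, map_add, h, DirectSum.add_apply]

lemma binary_smul_right (x y : E 0) (f : O) :
    L.binary x (f • y) = L.anchor x f • y + f • L.binary x y := by
  have h := L.leibniz (DirectSum.of E 0 x) (DirectSum.of E 0 y) f
  have h2 : DirectSum.of E 0 (f • y) = f • DirectSum.of E 0 y := by
    rw [← DirectSum.lof_eq_of O, map_smul, DirectSum.lof_eq_of]
  rw [binary, h2, h, DirectSum.add_apply, DirectSum.smul_apply, DirectSum.smul_apply,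
    DirectSum.of_eq_same, DirectSum.of_eq_same, binary]

lemma isHomogeneous_of (n : ℕ) (x : E n) :
    IsHomogeneousOfDegree (-((n : ℤ) + 1)) (DirectSum.of E n x) := by
  intro m hm
  apply DirectSum.of_eq_of_ne
  rintro rfl
  exact hm rfl

lemma eq_of_isHomogeneous {n : ℕ} {m : ℤ} (hm : m = -((n : ℤ) + 1)) {x : ⨁ n, E n}
    (hx : IsHomogeneousOfDegree m x) : x = DirectSum.of E n (x n) := by
  subst hm
  ext k
  by_cases hk : k = n
  · subst hk
    rw [DirectSum.of_eq_same]
  · rw [hx k (by omega), DirectSum.of_eq_of_ne _ _ _ hk]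

lemma eq_zero_of_isHomogeneous {m : ℤ} (hm : 0 ≤ m) {x : ⨁ n, E n}
    (hx : IsHomogeneousOfDegree m x) : x = 0 := by
  ext k
  rw [hx k (by omega), DirectSum.zero_apply]

lemma unary_zero (x : E 0) : L.bracket 0 ![DirectSum.of E 0 x] = 0 :=
  eq_zero_of_isHomogeneous (m := 0) le_rfl (by
    have h := L.bracket_degree 0 ![-1] ![DirectSum.of E 0 x] (by
      intro i
      fin_cases i
      exact isHomogeneous_of 0 x)
    simpa using h)

lemma unary_of (n : ℕ) (x : E (n + 1)) :
    L.bracket 0 ![DirectSum.of E (n + 1) x] = DirectSum.of E n (L.diff n x) := by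
  refine eq_of_isHomogeneous (m := -((n : ℤ) + 1)) rfl ?_
  have h := L.bracket_degree 0 ![-(((n + 1 : ℕ) : ℤ) + 1)] ![DirectSum.of E (n + 1) x] (by
    intro i
    fin_cases i
    exact isHomogeneous_of (n + 1) x)
  have e : (∑ i, ![-(((n + 1 : ℕ) : ℤ) + 1)] i) + 1 = -((n : ℤ) + 1) := by
    simp
  rwa [e] at h

lemma binary_of (x y : E 0) :
    L.bracket 1 ![DirectSum.of E 0 x, DirectSum.of E 0 y] = DirectSum.of E 0 (L.binary x y) := by
  refine eq_of_isHomogeneous (m := -1) (by simp) ?_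
  have h := L.bracket_degree 1 ![-1, -1] ![DirectSum.of E 0 x, DirectSum.of E 0 y] (by
    intro i
    fin_cases i <;> exact isHomogeneous_of 0 _)
  have e : (∑ i, ![(-1 : ℤ), -1] i) + 1 = -1 := by
    simp
  rwa [e] at h

lemma binary_swap (x y : E 0) : L.binary y x = - L.binary x y := by
  have h := L.bracket_perm 1 ![-1, -1] ![DirectSum.of E 0 x, DirectSum.of E 0 y] (by
    intro i
    fin_cases i <;> exact isHomogeneous_of 0 _) (Equiv.swap 0 1)
  have e1 : (fun i => (![DirectSum.of E 0 x, DirectSum.of E 0 y] : Fin 2 → _)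
      (Equiv.swap (0 : Fin 2) 1 i)) = ![DirectSum.of E 0 y, DirectSum.of E 0 x] := by
    funext i
    fin_cases i <;> rfl
  have e2 : koszulSign ![-1, -1] (Equiv.swap (0 : Fin 2) 1) = -1 := by
    decide
  rw [e1, e2, binary_of, binary_of] at h
  rw [Units.neg_smul, one_smul] at h
  apply DirectSum.of_injective (β := E) 0
  rw [h, map_neg]

lemma jacobi_two (deg : Fin 2 → ℤ) (x : Fin 2 → ⨁ n, E n)
    (hx : ∀ i, IsHomogeneousOfDegree (deg i) (x i)) :
    (∑ σ ∈ shuffles 1 2, koszulSign deg σ • L.bracket 1 ![L.bracket 0 ![x (σ 0)], x (σ 1)]) +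
      (∑ σ ∈ shuffles 2 2, koszulSign deg σ • L.bracket 0 ![L.bracket 1 ![x (σ 0), x (σ 1)]])
      = 0 := by
  have h := L.jacobi 1 deg x hx
  rw [Fin.sum_univ_two] at h
  rw [← h]
  refine congrArg₂ (· + ·) (Finset.sum_congr rfl fun σ _ => congrArg _ ?_)
    (Finset.sum_congr rfl fun σ _ => congrArg _ ?_)
  · refine congrArg (L.bracket 1) ?_
    funext i
    fin_cases i
    · refine congrArg (L.bracket 0) ?_
      funext i
      fin_cases i
      rfl
    · rfl
  · refine congrArg (L.bracket 0) ?_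
    funext i
    fin_cases i
    refine congrArg (L.bracket 1) ?_
    funext i
    fin_cases i <;> rfl

lemma jacobi_three (deg : Fin 3 → ℤ) (x : Fin 3 → ⨁ n, E n)
    (hx : ∀ i, IsHomogeneousOfDegree (deg i) (x i)) :
    (∑ σ ∈ shuffles 1 3,
        koszulSign deg σ • L.bracket 2 ![L.bracket 0 ![x (σ 0)], x (σ 1), x (σ 2)]) +
      (∑ σ ∈ shuffles 2 3,
        koszulSign deg σ • L.bracket 1 ![L.bracket 1 ![x (σ 0), x (σ 1)], x (σ 2)]) +
      (∑ σ ∈ shuffles 3 3,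
        koszulSign deg σ • L.bracket 0 ![L.bracket 2 ![x (σ 0), x (σ 1), x (σ 2)]]) = 0 := by
  have h := L.jacobi 2 deg x hx
  rw [Fin.sum_univ_three] at h
  rw [← h]
  refine congrArg₂ (· + ·) (congrArg₂ (· + ·) (Finset.sum_congr rfl fun σ _ => congrArg _ ?_)
    (Finset.sum_congr rfl fun σ _ => congrArg _ ?_))
    (Finset.sum_congr rfl fun σ _ => congrArg _ ?_)
  · refine congrArg (L.bracket 2) ?_
    funext i
    fin_cases i
    · refine congrArg (L.bracket 0) ?_
      funext i
      fin_cases i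
      rfl
    · rfl
    · rfl
  · refine congrArg (L.bracket 1) ?_
    funext i
    fin_cases i
    · refine congrArg (L.bracket 1) ?_
      funext i
      fin_cases i <;> rfl
    · rfl
  · refine congrArg (L.bracket 0) ?_
    funext i
    fin_cases i
    refine congrArg (L.bracket 2) ?_
    funext i
    fin_cases i <;> rfl

lemma bracket_eq_zero (k : ℕ) (x : Fin (k + 1) → ⨁ n, E n) (i : Fin (k + 1)) (h : x i = 0) :
    L.bracket k x = 0 :=
  (L.bracket k).map_coord_zero i h

lemma binary_diff_mem (z : E 1) (y : E 0) :
    L.binary (L.diff 0 z) y ∈ LinearMap.range (L.diff 0) := by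
  have h := L.jacobi_two ![-2, -1] ![DirectSum.of E 1 z, DirectSum.of E 0 y] (by
    intro i
    fin_cases i
    · exact isHomogeneous_of 1 _
    · exact isHomogeneous_of 0 _)
  have s1 : shuffles 1 2 = {1, Equiv.swap 0 1} := by decide
  have s2 : shuffles 2 2 = {1} := by decide
  have e1 : koszulSign ![-2, -1] (1 : Equiv.Perm (Fin 2)) = 1 := by decide
  rw [s1, s2, Finset.sum_pair (by decide), Finset.sum_singleton, e1] at h
  simp only [Equiv.Perm.one_apply, Equiv.swap_apply_left, Equiv.swap_apply_right,
    Matrix.cons_val_zero, Matrix.cons_val_one, one_smul] at h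
  have hw : L.bracket 1 ![DirectSum.of E 1 z, DirectSum.of E 0 y] =
      DirectSum.of E 1 (L.bracket 1 ![DirectSum.of E 1 z, DirectSum.of E 0 y] 1) := by
    refine eq_of_isHomogeneous (m := -2) (by simp) ?_
    have h := L.bracket_degree 1 ![-2, -1] ![DirectSum.of E 1 z, DirectSum.of E 0 y] (by
      intro i
      fin_cases i
      · exact isHomogeneous_of 1 _
      · exact isHomogeneous_of 0 _)
    have e : (∑ i, ![(-2 : ℤ), -1] i) + 1 = -2 := by
      simp
    rwa [e] at h
  rw [hw, unary_zero, L.bracket_eq_zero 1 ![0, DirectSum.of E 1 z] 0 rfl, smul_zero, add_zero,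
    L.unary_of 0, L.unary_of 0, L.binary_of, ← map_add] at h
  have h' := DirectSum.of_injective (β := E) 0 (h.trans (map_zero _).symm)
  rw [eq_neg_of_add_eq_zero_left h']
  exact neg_mem (LinearMap.mem_range_self _ _)

lemma binary_jacobi (x y z : E 0) :
    L.binary (L.binary x y) z - L.binary (L.binary x z) y + L.binary (L.binary y z) x
      ∈ LinearMap.range (L.diff 0) := by
  have hx : ∀ i, IsHomogeneousOfDegree ((![-1, -1, -1] : Fin 3 → ℤ) i)
      ((![DirectSum.of E 0 x, DirectSum.of E 0 y, DirectSum.of E 0 z] : Fin 3 → ⨁ n, E n) i) := by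
    intro i
    fin_cases i <;> exact isHomogeneous_of 0 _
  have h := L.jacobi_three ![-1, -1, -1]
    ![DirectSum.of E 0 x, DirectSum.of E 0 y, DirectSum.of E 0 z] hx
  have s1 : shuffles 1 3 = {1, Equiv.swap 0 1, finRotate 3 * finRotate 3} := by decide
  have s2 : shuffles 2 3 = {1, Equiv.swap 1 2, finRotate 3} := by decide
  have s3 : shuffles 3 3 = {1} := by decide
  have hz : ∀ i, L.bracket 0 ![(![DirectSum.of E 0 x, DirectSum.of E 0 y, DirectSum.of E 0 z] :
      Fin 3 → ⨁ n, E n) i] = 0 := by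
    intro i
    fin_cases i <;> exact L.unary_zero _
  have e1 : koszulSign ![-1, -1, -1] (1 : Equiv.Perm (Fin 3)) = 1 := by decide
  have e2 : koszulSign ![-1, -1, -1] (Equiv.swap (1 : Fin 3) 2) = -1 := by decide
  have e3 : koszulSign ![-1, -1, -1] (finRotate 3) = 1 := by decide
  have t1 : ∀ σ ∈ shuffles 1 3, koszulSign ![-1, -1, -1] σ • L.bracket 2
      ![L.bracket 0 ![(![DirectSum.of E 0 x, DirectSum.of E 0 y, DirectSum.of E 0 z] :
        Fin 3 → ⨁ n, E n) (σ 0)],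
        (![DirectSum.of E 0 x, DirectSum.of E 0 y, DirectSum.of E 0 z] :
          Fin 3 → ⨁ n, E n) (σ 1),
        (![DirectSum.of E 0 x, DirectSum.of E 0 y, DirectSum.of E 0 z] :
          Fin 3 → ⨁ n, E n) (σ 2)] = 0 := by
    intro σ _
    rw [L.bracket_eq_zero 2 _ 0 (hz _), smul_zero]
  have hw : L.bracket 2 ![DirectSum.of E 0 x, DirectSum.of E 0 y, DirectSum.of E 0 z] =
      DirectSum.of E 1
        (L.bracket 2 ![DirectSum.of E 0 x, DirectSum.of E 0 y, DirectSum.of E 0 z] 1) := by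
    refine eq_of_isHomogeneous (m := -2) (by simp) ?_
    have h := L.bracket_degree 2 ![-1, -1, -1] _ hx
    have e : (∑ i, (![-1, -1, -1] : Fin 3 → ℤ) i) + 1 = -2 := by decide
    rwa [e] at h
  rw [Finset.sum_eq_zero t1, zero_add, s2, s3, Finset.sum_insert (by decide),
    Finset.sum_pair (by decide), Finset.sum_singleton, e1, e2, e3] at h
  have r0 : finRotate 3 0 = 1 := by decide
  have r1 : finRotate 3 1 = 2 := by decide
  have r2 : finRotate 3 2 = 0 := by decide
  have q0 : Equiv.swap (1 : Fin 3) 2 0 = 0 := by decide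
  simp only [Equiv.Perm.one_apply, Equiv.swap_apply_left, Equiv.swap_apply_right, r0, r1, r2, q0,
    Matrix.cons_val_zero, Matrix.cons_val_one, Matrix.cons_val, one_smul, Units.neg_smul] at h
  rw [hw, L.unary_of 0] at h
  simp only [binary_of, ← map_add, ← map_neg] at h
  have h' := DirectSum.of_injective (β := E) 0 (h.trans (map_zero _).symm)
  have h2 : L.binary (L.binary x y) z - L.binary (L.binary x z) y + L.binary (L.binary y z) x =
      -L.diff 0 (L.bracket 2 ![DirectSum.of E 0 x, DirectSum.of E 0 y, DirectSum.of E 0 z] 1) := by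
    apply eq_neg_of_add_eq_zero_left
    rw [← h']
    abel
  rw [h2]
  exact neg_mem (LinearMap.mem_range_self _ _)

lemma binary_congr {x x' y y' : E 0} (hx : x - x' ∈ LinearMap.range (L.diff 0))
    (hy : y - y' ∈ LinearMap.range (L.diff 0)) :
    L.binary x y - L.binary x' y' ∈ LinearMap.range (L.diff 0) := by
  obtain ⟨u, hu⟩ := hx
  obtain ⟨v, hv⟩ := hy
  have h1 : L.binary x y = L.binary x' y + L.binary (L.diff 0 u) y := by
    rw [hu, ← binary_add_left, add_sub_cancel]
  have h2 : L.binary x' y = L.binary x' y' - L.binary (L.diff 0 v) x' := by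
    rw [hv, L.binary_swap x', sub_neg_eq_add, ← binary_add_right, add_sub_cancel]
  rw [h1, h2, show ∀ a b c : E 0, a - b + c - a = c - b by intros; abel]
  exact sub_mem (L.binary_diff_mem _ _) (L.binary_diff_mem _ _)

/-- The underlying module `𝓔₋₁ / ℓ₁(𝓔₋₂)` of the basic Lie-Rinehart algebra. Its bracket and its
anchor, given below, are induced by `ℓ₂` and by the anchor of the Lie `∞`-algebroid. -/
def Basic (L : LieInftyAlgebroid K O E) : Type uE := E 0 ⧸ LinearMap.range (L.diff 0)

namespace Basic

instance : AddCommGroup L.Basic := inferInstanceAs (AddCommGroup (E 0 ⧸ LinearMap.range (L.diff 0)))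

instance : Module O L.Basic := inferInstanceAs (Module O (E 0 ⧸ LinearMap.range (L.diff 0)))

instance : Module K L.Basic := inferInstanceAs (Module K (E 0 ⧸ LinearMap.range (L.diff 0)))

instance : IsScalarTower K O L.Basic :=
  inferInstanceAs (IsScalarTower K O (E 0 ⧸ LinearMap.range (L.diff 0)))

/-- The projection `𝓔₋₁ → 𝓔₋₁ / ℓ₁(𝓔₋₂)`. -/
def proj : E 0 →ₗ[O] L.Basic := Submodule.mkQ (LinearMap.range (L.diff 0))

lemma proj_surjective : Function.Surjective (proj L) := Submodule.mkQ_surjective _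

lemma proj_eq_proj_iff (x y : E 0) :
    proj L x = proj L y ↔ x - y ∈ LinearMap.range (L.diff 0) :=
  Submodule.Quotient.eq _

/-- The anchor induced on the quotient. -/
def anchor : L.Basic →ₗ[O] Derivation K O O :=
  (LinearMap.range (L.diff 0)).liftQ L.anchor (by
    rintro _ ⟨z, rfl⟩
    exact L.anchor_unary z)

lemma anchor_proj (x : E 0) : anchor L (proj L x) = L.anchor x := rfl

instance : Bracket L.Basic L.Basic where
  bracket := Quotient.map₂ L.binary (by
    intro x x' hx y y' hy
    exact (Submodule.quotientRel_def _).mpr (L.binary_congr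
      ((Submodule.quotientRel_def _).mp hx) ((Submodule.quotientRel_def _).mp hy)))

lemma proj_lie (x y : E 0) : ⁅proj L x, proj L y⁆ = proj L (L.binary x y) := rfl

instance [CharZero K] : LieRing L.Basic where
  add_lie a b c := by
    obtain ⟨x, rfl⟩ := proj_surjective L a
    obtain ⟨y, rfl⟩ := proj_surjective L b
    obtain ⟨z, rfl⟩ := proj_surjective L c
    rw [← map_add, proj_lie, proj_lie, proj_lie, binary_add_left, map_add]
  lie_add a b c := by
    obtain ⟨x, rfl⟩ := proj_surjective L a
    obtain ⟨y, rfl⟩ := proj_surjective L b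
    obtain ⟨z, rfl⟩ := proj_surjective L c
    rw [← map_add, proj_lie, proj_lie, proj_lie, binary_add_right, map_add]
  lie_self a := by
    obtain ⟨x, rfl⟩ := proj_surjective L a
    have h : (2 : K) • L.binary x x = 0 := by
      rw [two_smul]
      nth_rewrite 1 [L.binary_swap x x]
      exact neg_add_cancel _
    rw [proj_lie, (smul_eq_zero_iff_right (two_ne_zero (α := K))).mp h, map_zero]
  leibniz_lie a b c := by
    obtain ⟨x, rfl⟩ := proj_surjective L a
    obtain ⟨y, rfl⟩ := proj_surjective L b
    obtain ⟨z, rfl⟩ := proj_surjective L c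
    simp only [proj_lie, ← map_add]
    rw [proj_eq_proj_iff, L.binary_swap (L.binary y z) x, L.binary_swap (L.binary x z) y]
    have h := neg_mem (L.binary_jacobi x y z)
    convert h using 1
    abel

instance [CharZero K] : LieAlgebra K L.Basic where
  lie_smul c a b := by
    obtain ⟨x, rfl⟩ := proj_surjective L a
    obtain ⟨y, rfl⟩ := proj_surjective L b
    rw [← algebraMap_smul O c (proj L y), ← map_smul, proj_lie, proj_lie, binary_smul_right,
      Derivation.map_algebraMap, zero_smul, zero_add, map_smul, algebraMap_smul]

instance [CharZero K] : LieRingModule L.Basic O where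
  bracket a f := anchor L a f
  add_lie a b f := by
    change anchor L (a + b) f = anchor L a f + anchor L b f
    rw [map_add, Derivation.add_apply]
  lie_add a f g := map_add (anchor L a) f g
  leibniz_lie a b f := by
    obtain ⟨x, rfl⟩ := proj_surjective L a
    obtain ⟨y, rfl⟩ := proj_surjective L b
    change L.anchor x (L.anchor y f) = L.anchor (L.binary x y) f + L.anchor y (L.anchor x f)
    rw [binary, L.anchor_binary, Derivation.commutator_apply, sub_add_cancel]

lemma lie_eq_anchor [CharZero K] (a : L.Basic) (f : O) : ⁅a, f⁆ = anchor L a f := rfl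

instance [CharZero K] : LieRinehartRing O L.Basic where
  lie_smul_eq_mul' f g a := by
    rw [lie_eq_anchor, lie_eq_anchor, map_smul, Derivation.smul_apply, smul_eq_mul]
  leibniz_mul_right' a f g := by
    simp only [lie_eq_anchor, Derivation.leibniz, smul_eq_mul]
    ring
  leibniz_smul_right' a b f := by
    obtain ⟨x, rfl⟩ := proj_surjective L a
    obtain ⟨y, rfl⟩ := proj_surjective L b
    rw [lie_eq_anchor, anchor_proj, ← map_smul, proj_lie, proj_lie, binary_smul_right, map_add,
      map_smul, map_smul, add_comm]

instance [CharZero K] : LieRinehartAlgebra K O L.Basic where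
  smul_lie c a f := by
    rw [lie_eq_anchor, lie_eq_anchor, ← algebraMap_smul O c a, map_smul, Derivation.smul_apply,
      algebraMap_smul]
  lie_smul c a f := by
    rw [lie_eq_anchor, lie_eq_anchor, Derivation.map_smul]

end Basic

/-- The Lie `∞`-algebroid covers the Lie-Rinehart algebra `A` through the hook `π`. -/
structure Covers {A : Type uA} [LieRing A] [Module O A] [LieRingModule A O] [LieRinehartRing O A]
    [LieAlgebra K A] [LieRinehartAlgebra K O A] (π : E 0 →ₗ[O] A) : Prop where
  map_binary : ∀ x y, π (L.binary x y) = ⁅π x, π y⁆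
  anchor_comp : ∀ x, LieRinehartAlgebra.anchor K O A (π x) = L.anchor x
  surjective : Function.Surjective π

end

end LieInftyAlgebroid

/-! The brackets are built by obstruction theory. An `AlmostAlgebroid` has everything except the
higher Jacobi identities: graded symmetric brackets of degree 1 with unary part `d`, the Leibniz
rule, and compatibility with the augmentation `π` and the bracket of `A`. One such family exists.
The flat connection of a homogeneous basis gives the binary bracket `∇_{πx} y + (-1)^{|x|} ∇_{πy}
x`, which obeys the Leibniz rule; in degree `-1` its image under `π` misses the bracket of `A` by an
`O`-bilinear defect, and this lifts through `π` because `𝓔₋₁` is free (`exists_bracket_lift`,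
`almostAlgebroid_baseBrackets`).

The remaining obstruction is the Jacobiator `J`. It is graded symmetric. It is `O`-multilinear
although `ℓ₂` is not: the first-order anchor terms cancel in pairs and the second-order ones vanish
because the anchor of `A` is a Lie algebra morphism (`jacobiator_smul_head`). It is killed by `π`
because `A` satisfies the Jacobi identity (`aug_jacobiator`). Finally, if `J` vanishes in total
degrees `> -D`, the Bianchi identity `[Q, Q²] = 0` gives `d J = 0` on words of degree `-D` in
letters of negative degree (`bianchi`, `totalDiff_jacobiator`). Exactness then yields `c` with `d c
= -J` on basis words of degree `-D`; averaging over permutations, possible in characteristic zero,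
makes `c` graded symmetric (`exists_symmetric_lift`). Adding `c` alters `J` in degrees `≥ -D` only
by `d c` in degree `-D` itself (`exists_correction`).

The induction runs over the total degree of the inputs, so each step treats all arities at once. It
starts at `D = 3`: on words of degree `≥ -2` the Jacobiator has degree `≥ 0` and is zero, and for `D
≥ 3` the correction lies in degrees `≤ -2`, where `π` vanishes. A given word meets only finitely
many corrections, hence the brackets converge (`exists_homotopy_brackets`).

Brackets are handled as functions of lists, and sums over shuffles as the recursively defined
`unshuffleSum`; `unshuffleSum_ofFn` translates back to permutations. The corollary applies the
theorem to a canonical free resolution, for which `π` identifies `𝓔₋₁ / d 𝓔₋₂` with `A`. -/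

/-! ### Signed sums over unshuffles of a word, and graded symmetry. -/

section Unshuffle

variable {α : Type*} {M N : Type*} [AddCommGroup M] [AddCommGroup N] (deg : α → ℤ)

/-- The total degree of a word. -/
def wordDegree (w : List α) : ℤ := (w.map deg).sum

@[simp] lemma wordDegree_nil : wordDegree deg [] = 0 := rfl

@[simp] lemma wordDegree_cons (a : α) (w : List α) :
    wordDegree deg (a :: w) = deg a + wordDegree deg w := by simp [wordDegree]

@[simp] lemma wordDegree_append (u v : List α) :
    wordDegree deg (u ++ v) = wordDegree deg u + wordDegree deg v := by simp [wordDegree]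

lemma List.Perm.wordDegree_eq {u v : List α} (h : u.Perm v) :
    wordDegree deg u = wordDegree deg v := (h.map deg).sum_eq

/-- The sum of `φ u v` over all ways to unshuffle a word into two words `u` and `v`, weighted by
the Koszul signs. -/
def unshuffleSum : (List α → List α → M) → List α → M
  | φ, [] => φ [] []
  | φ, a :: w => unshuffleSum (fun u v => φ (a :: u) v) w +
      unshuffleSum (fun u v => (deg a * wordDegree deg u).negOnePow • φ u (a :: v)) w

@[simp] lemma unshuffleSum_nil (φ : List α → List α → M) : unshuffleSum deg φ [] = φ [] [] := rfl

lemma unshuffleSum_cons (φ : List α → List α → M) (a : α) (w : List α) :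
    unshuffleSum deg φ (a :: w) = unshuffleSum deg (fun u v => φ (a :: u) v) w +
      unshuffleSum deg (fun u v => (deg a * wordDegree deg u).negOnePow • φ u (a :: v)) w := rfl

lemma unshuffleSum_congr {φ ψ : List α → List α → M} {w : List α}
    (h : ∀ u v, (u ++ v).Perm w → φ u v = ψ u v) :
    unshuffleSum deg φ w = unshuffleSum deg ψ w := by
  induction w generalizing φ ψ with
  | nil => exact h [] [] (.refl _)
  | cons a w ih =>
    rw [unshuffleSum_cons, unshuffleSum_cons]
    congr 1
    · exact ih fun u v huv => h _ _ (huv.cons a)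
    · exact ih fun u v huv => by rw [h u (a :: v) (List.perm_middle.trans (huv.cons a))]

lemma unshuffleSum_congr' {φ ψ : List α → List α → M} {w : List α} (h : ∀ u v, φ u v = ψ u v) :
    unshuffleSum deg φ w = unshuffleSum deg ψ w := unshuffleSum_congr deg fun u v _ => h u v

lemma unshuffleSum_add (φ ψ : List α → List α → M) (w : List α) :
    unshuffleSum deg (fun u v => φ u v + ψ u v) w =
      unshuffleSum deg φ w + unshuffleSum deg ψ w := by
  induction w generalizing φ ψ with
  | nil => rfl
  | cons a w ih =>
    simp only [unshuffleSum_cons, smul_add, ih]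
    abel

lemma map_unshuffleSum (g : M →+ N) (φ : List α → List α → M) (w : List α) :
    g (unshuffleSum deg φ w) = unshuffleSum deg (fun u v => g (φ u v)) w := by
  induction w generalizing φ with
  | nil => rfl
  | cons a w ih =>
    simp only [unshuffleSum_cons, map_add, ih]
    congr 1
    refine unshuffleSum_congr' deg fun u v => ?_
    rw [Units.smul_def, Units.smul_def, map_zsmul]

lemma unshuffleSum_smul {R : Type*} [Monoid R] [DistribMulAction R M] (r : R)
    (φ : List α → List α → M) (w : List α) :
    unshuffleSum deg (fun u v => r • φ u v) w = r • unshuffleSum deg φ w :=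
  (map_unshuffleSum deg (DistribSMul.toAddMonoidHom M r) φ w).symm

lemma unshuffleSum_mem {S : AddSubgroup M} {φ : List α → List α → M} {w : List α}
    (h : ∀ u v, (u ++ v).Perm w → φ u v ∈ S) : unshuffleSum deg φ w ∈ S := by
  induction w generalizing φ with
  | nil => exact h [] [] (.refl _)
  | cons a w ih =>
    refine add_mem (ih fun u v huv => h _ _ (huv.cons a)) (ih fun u v huv => ?_)
    rw [Units.smul_def]
    exact zsmul_mem (h u (a :: v) (List.perm_middle.trans (huv.cons a))) _

lemma unshuffleSum_eq_zero {φ : List α → List α → M} {w : List α}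
    (h : ∀ u v, (u ++ v).Perm w → φ u v = 0) : unshuffleSum deg φ w = 0 :=
  unshuffleSum_mem deg (S := ⊥) h

/-- Only the trivial unshuffle has an empty second word. This isolates the terms of a Jacobiator
whose outer bracket is unary. -/
lemma unshuffleSum_right_nil (φ : List α → M) (w : List α) :
    unshuffleSum deg (fun u v => if v = [] then φ u else 0) w = φ w := by
  induction w generalizing φ with
  | nil => rfl
  | cons a w ih =>
    rw [unshuffleSum_cons, ih fun u => φ (a :: u), unshuffleSum_eq_zero, add_zero]
    simp

lemma negOnePow_congr {m n : ℤ} (k : ℤ) (h : m - n = 2 * k) : m.negOnePow = n.negOnePow := by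
  rw [Int.negOnePow_eq_iff, h]
  exact even_two_mul k

/-- Cocommutativity of unshuffling: interchanging the two subwords exchanges the two branches of the
recursion. -/
lemma unshuffleSum_comm (φ : List α → List α → M) (w : List α) :
    unshuffleSum deg φ w = unshuffleSum deg
      (fun u v => (wordDegree deg u * wordDegree deg v).negOnePow • φ v u) w := by
  induction w generalizing φ with
  | nil => simp
  | cons a w ih =>
    rw [unshuffleSum_cons, unshuffleSum_cons, ih fun u v => φ (a :: u) v,
      ih fun u v => (deg a * wordDegree deg u).negOnePow • φ u (a :: v), add_comm]
    congr 1
    · refine unshuffleSum_congr' deg fun u v => ?_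
      rw [smul_smul, ← Int.negOnePow_add, wordDegree_cons]
      congr 2
      ring
    · refine unshuffleSum_congr' deg fun u v => ?_
      rw [smul_smul, ← Int.negOnePow_add, wordDegree_cons]
      congr 1
      exact negOnePow_congr (-(deg a * wordDegree deg u)) (by ring)

/-- Coassociativity: both sides run over all unshuffles into three words. -/
lemma unshuffleSum_assoc (φ : List α → List α → List α → M) (w : List α) :
    unshuffleSum deg (fun u v => unshuffleSum deg (fun a b => φ a b v) u) w =
      unshuffleSum deg (fun a t => unshuffleSum deg (fun b v => φ a b v) t) w := by
  induction w generalizing φ with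
  | nil => rfl
  | cons x w ih =>
    simp only [unshuffleSum_cons, unshuffleSum_add]
    -- A letter going to the third word passes both other words; its sign splits because the degree
    -- of `u` is the sum of those of `a` and `b`.
    have e : unshuffleSum deg (fun u v => (deg x * wordDegree deg u).negOnePow •
          unshuffleSum deg (fun a b => φ a b (x :: v)) u) w =
        unshuffleSum deg (fun u v => unshuffleSum deg (fun a b =>
          (deg x * wordDegree deg a).negOnePow • (deg x * wordDegree deg b).negOnePow •
            φ a b (x :: v)) u) w := by
      refine unshuffleSum_congr' deg fun u v => ?_
      rw [← unshuffleSum_smul]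
      refine unshuffleSum_congr deg fun a b hab => ?_
      rw [← hab.wordDegree_eq deg, smul_smul, ← Int.negOnePow_add, wordDegree_append, mul_add]
    rw [ih fun a b v => φ (x :: a) b v,
      ih fun a b v => (deg x * wordDegree deg a).negOnePow • φ a (x :: b) v, e,
      ih fun a b v => (deg x * wordDegree deg a).negOnePow • (deg x * wordDegree deg b).negOnePow •
            φ a b (x :: v), add_assoc]
    simp only [← unshuffleSum_add, ← unshuffleSum_smul, smul_add]

/-- Graded symmetry of a function of words: two neighbouring letters may be interchanged. -/
def GradedSymmetric (φ : List α → M) : Prop :=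
  ∀ (u v : List α) (a b : α),
    φ (u ++ a :: b :: v) = (deg a * deg b).negOnePow • φ (u ++ b :: a :: v)

lemma GradedSymmetric.move {φ : List α → M} (h : GradedSymmetric deg φ) (u v : List α) (a : α) :
    φ (u ++ a :: v) = (deg a * wordDegree deg u).negOnePow • φ (a :: (u ++ v)) := by
  induction u using List.reverseRecOn generalizing v with
  | nil => simp
  | append_singleton u c ih =>
    rw [List.append_assoc, List.singleton_append, h u v c a, ih, smul_smul, ← Int.negOnePow_add]
    simp only [wordDegree_append, wordDegree_cons, wordDegree_nil, List.append_assoc,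
      List.singleton_append]
    congr 2
    ring

/-- If the two letters land in the same subword, the symmetry of `φ` there applies; if they are
separated, the two mixed terms are interchanged, and the unshuffle signs account for the factor. -/
lemma GradedSymmetric.unshuffleSum {φ : List α → List α → M}
    (hl : ∀ v, GradedSymmetric deg fun u => φ u v) (hr : ∀ u, GradedSymmetric deg (φ u)) :
    GradedSymmetric deg (unshuffleSum deg φ) := by
  intro u
  induction u generalizing φ with
  | nil =>
    intro v a b
    simp only [List.nil_append, unshuffleSum_cons, ← unshuffleSum_smul, smul_add,
      ← unshuffleSum_add]
    refine unshuffleSum_congr' deg fun s t => ?_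
    have h1 := hl t [] s a b
    have h2 := hr s [] t a b
    simp only [List.nil_append] at h1 h2
    rw [h1, h2]
    simp only [smul_smul, ← Int.negOnePow_add, wordDegree_cons]
    have e1 : (deg a * (deg b + wordDegree deg s)).negOnePow =
      (deg a * deg b + deg a * wordDegree deg s).negOnePow := by rw [mul_add]
    have e2 : (deg a * deg b + deg b * (deg a + wordDegree deg s)).negOnePow =
      (deg b * wordDegree deg s).negOnePow := negOnePow_congr (deg a * deg b) (by ring)
    rw [e1, e2]
    simp only [add_assoc, add_comm, add_left_comm]
  | cons c u ih =>
    intro v a b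
    simp only [List.cons_append, unshuffleSum_cons, smul_add]
    congr 1
    · exact ih (fun v u' v' a b => hl v (c :: u') v' a b) (fun u => hr (c :: u)) v a b
    · refine ih (fun v u' v' a b => ?_) (fun u u' v' a b => ?_) v a b
      · have := hl (c :: v) u' v' a b
        simp only at this ⊢
        rw [this, smul_smul, smul_smul, mul_comm]
        congr 4
        simp only [wordDegree_append, wordDegree_cons]
        ring
      · have := hr u (c :: u') v' a b
        simp only [List.cons_append] at this
        simp only [this, smul_smul, mul_comm]

end Unshuffle

/-! ### Graded brackets, their Jacobiator and the Bianchi identity. -/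

section Brackets

variable {E : ℕ → Type uE} [∀ n, AddCommGroup (E n)]

lemma IsHomogeneousOfDegree.zero (m : ℤ) : IsHomogeneousOfDegree m (0 : ⨁ n, E n) :=
  fun _ _ => rfl

/-- The homogeneous elements of degree `m`, as a subgroup. -/
def homogeneousSubgroup (E : ℕ → Type uE) [∀ n, AddCommGroup (E n)] (m : ℤ) :
    AddSubgroup (⨁ n, E n) where
  carrier := {x | IsHomogeneousOfDegree m x}
  zero_mem' := .zero m
  add_mem' ha hb n hn := by rw [DirectSum.add_apply, ha n hn, hb n hn, add_zero]
  neg_mem' {a} ha n hn := by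
    have : (-a) n = -(a n) := map_neg (DirectSum.component ℤ ℕ E n) a
    rw [this, ha n hn, neg_zero]

lemma mem_homogeneousSubgroup {m : ℤ} {x : ⨁ n, E n} :
    x ∈ homogeneousSubgroup E m ↔ IsHomogeneousOfDegree m x := Iff.rfl

/-- A homogeneous element together with its degree. -/
structure Letter (E : ℕ → Type uE) [∀ n, AddCommGroup (E n)] where
  deg : ℤ
  val : ⨁ n, E n
  homog : IsHomogeneousOfDegree deg val

/-- The elements underlying a word. -/
def vals (w : List (Letter E)) : List (⨁ n, E n) := w.map Letter.val

@[simp] lemma vals_nil : vals ([] : List (Letter E)) = [] := rfl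

@[simp] lemma vals_cons (a : Letter E) (w : List (Letter E)) :
    vals (a :: w) = a.val :: vals w := rfl

@[simp] lemma vals_append (u v : List (Letter E)) : vals (u ++ v) = vals u ++ vals v := by
  simp [vals]

@[simp] lemma length_vals (w : List (Letter E)) : (vals w).length = w.length := by
  simp [vals]

/-- A function of words is multilinear if it is linear in every letter. -/
structure WordMultilinear (S : Type*) [Semiring S] {M N : Type*} [AddCommMonoid M]
    [AddCommMonoid N] [Module S M] [Module S N] (q : List M → N) : Prop where
  add : ∀ u v a b, q (u ++ (a + b) :: v) = q (u ++ a :: v) + q (u ++ b :: v)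
  smul : ∀ u v (c : S) a, q (u ++ (c • a) :: v) = c • q (u ++ a :: v)

lemma WordMultilinear.zero {S : Type*} [Semiring S] {M N : Type*} [AddCommMonoid M]
    [AddCommMonoid N] [Module S M] [Module S N] {q : List M → N} (h : WordMultilinear S q)
    (u v) : q (u ++ 0 :: v) = 0 := by
  simpa using h.smul u v 0 0

/-- A family of multilinear, graded symmetric brackets of degree `1`. -/
structure GradedBrackets (K : Type uK) [Field K] [∀ n, Module K (E n)]
    (q : List (⨁ n, E n) → ⨁ n, E n) : Prop where
  multilinear : WordMultilinear K q
  symm : GradedSymmetric Letter.deg fun w => q (vals w)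
  homog : ∀ w, IsHomogeneousOfDegree (wordDegree Letter.deg w + 1) (q (vals w))
  nil : q [] = 0

/-- The left hand side of the higher Jacobi identity. -/
def jacobiator (q : List (⨁ n, E n) → ⨁ n, E n) (w : List (Letter E)) : ⨁ n, E n :=
  unshuffleSum Letter.deg (fun u v => q (q (vals u) :: vals v)) w

namespace GradedBrackets

variable {K : Type uK} [Field K] [∀ n, Module K (E n)]
  {q : List (⨁ n, E n) → ⨁ n, E n}

lemma add_head (h : GradedBrackets K q) (a b : ⨁ n, E n) (v) :
    q ((a + b) :: v) = q (a :: v) + q (b :: v) :=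
  h.multilinear.add [] v a b

lemma zero_head (h : GradedBrackets K q) (v) : q (0 :: v) = 0 := h.multilinear.zero [] v

/-- The bracket as a function of its first argument. -/
def headHom (h : GradedBrackets K q) (v : List (⨁ n, E n)) : (⨁ n, E n) →+ ⨁ n, E n where
  toFun a := q (a :: v)
  map_zero' := h.zero_head v
  map_add' a b := h.add_head a b v

/-- The bracket of a word, as a letter. -/
def output (h : GradedBrackets K q) (w : List (Letter E)) : Letter E :=
  ⟨wordDegree Letter.deg w + 1, q (vals w), h.homog w⟩

@[simp] lemma output_deg (h : GradedBrackets K q) (w : List (Letter E)) :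
  (h.output w).deg = wordDegree Letter.deg w + 1 := rfl

@[simp] lemma output_val (h : GradedBrackets K q) (w : List (Letter E)) :
  (h.output w).val = q (vals w) := rfl

variable (h : GradedBrackets K q)

include h

lemma symm_head (a b : Letter E) (w : List (Letter E)) :
    q (a.val :: b.val :: vals w) = (a.deg * b.deg).negOnePow • q (b.val :: a.val :: vals w) :=
  h.symm [] w a b

lemma jacobiator_homog (w : List (Letter E)) :
    IsHomogeneousOfDegree (wordDegree Letter.deg w + 2) (jacobiator q w) := by
  refine mem_homogeneousSubgroup.1 (unshuffleSum_mem _ fun u v huv => ?_)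
  have := h.homog (h.output u :: v)
  rw [wordDegree_cons, output_deg] at this
  rw [mem_homogeneousSubgroup, ← huv.wordDegree_eq, wordDegree_append]
  rwa [show wordDegree Letter.deg u + wordDegree Letter.deg v + 2 =
    wordDegree Letter.deg u + 1 + wordDegree Letter.deg v + 1 by ring]

lemma jacobiator_symm : GradedSymmetric Letter.deg (jacobiator (E := E) q) := by
  refine GradedSymmetric.unshuffleSum _ (fun v u' v' a b => ?_) fun u u' v' a b => ?_
  · have h1 := h.symm u' v' a b
    simp only at h1 ⊢
    rw [h1, Units.smul_def, Units.smul_def]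
    exact map_zsmul (h.headHom (vals v)) _ _
  · exact h.symm (h.output u :: u') v' a b

/-- The inserted bracket lies in the inner bracket (nested terms) or beside it (terms that are not
nested). -/
lemma jacobiator_output_cons (u v : List (Letter E)) :
    jacobiator q (h.output u :: v) =
      unshuffleSum Letter.deg (fun a b => q (q (q (vals u) :: vals a) :: vals b)) v +
      unshuffleSum Letter.deg (fun a b => ((wordDegree Letter.deg u + 1) *
        wordDegree Letter.deg a).negOnePow • q (q (vals a) :: q (vals u) :: vals b)) v := rfl

variable [CharZero K]

/-- The terms in which the two inner brackets are not nested cancel. -/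
lemma sum_not_nested (w : List (Letter E)) :
    unshuffleSum Letter.deg (fun u v => unshuffleSum Letter.deg (fun a b =>
      ((wordDegree Letter.deg u + 1) * wordDegree Letter.deg a).negOnePow •
        q (q (vals a) :: q (vals u) :: vals b)) v) w = 0 := by
  -- Regrouping puts the two inner words side by side, so that they can be interchanged.
  rw [← unshuffleSum_assoc Letter.deg (fun u a b =>
    ((wordDegree Letter.deg u + 1) * wordDegree Letter.deg a).negOnePow •
        q (q (vals a) :: q (vals u) :: vals b))]
  set T := unshuffleSum Letter.deg (fun t b => unshuffleSum Letter.deg (fun u a =>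
    ((wordDegree Letter.deg u + 1) * wordDegree Letter.deg a).negOnePow •
        q (q (vals a) :: q (vals u) :: vals b)) t) w with hT
  -- Interchanging the inner words costs `|u||a|`, and interchanging their brackets, of degrees `|u|
  -- + 1` and `|a| + 1`, costs `(|u| + 1)(|a| + 1)`. Together with the given sign this leaves one
  -- extra `-1`.
  have e : T = -T := by
    conv_lhs => rw [hT]
    rw [hT, ← neg_one_smul ℤ, ← unshuffleSum_smul]
    refine unshuffleSum_congr' _ fun t b => ?_
    rw [← unshuffleSum_smul, unshuffleSum_comm]
    refine unshuffleSum_congr' _ fun u a => ?_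
    have := h.symm_head (h.output u) (h.output a) b
    simp only [output_deg, output_val] at this
    rw [this, smul_smul, smul_smul, ← Int.negOnePow_add, ← Int.negOnePow_add,
      neg_one_smul, ← Units.neg_smul, ← Int.negOnePow_succ]
    congr 1
    exact negOnePow_congr (wordDegree Letter.deg u * wordDegree Letter.deg a +
      wordDegree Letter.deg u) (by ring)
  have h2 : (2 : K) • T = 0 := by
    rw [two_smul]
    nth_rewrite 1 [e]
    exact neg_add_cancel T
  exact (smul_eq_zero_iff_right two_ne_zero).mp h2

/-- The Bianchi identity `[Q, Q²] = 0`. -/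
lemma bianchi (w : List (Letter E)) :
    unshuffleSum Letter.deg (fun u v => q (jacobiator q u :: vals v)) w =
      unshuffleSum Letter.deg (fun u v => jacobiator q (h.output u :: v)) w := by
  have e : ∀ u v : List (Letter E), q (jacobiator q u :: vals v) =
      unshuffleSum Letter.deg (fun a b => q (q (q (vals a) :: vals b) :: vals v)) u :=
    fun u v => map_unshuffleSum Letter.deg (h.headHom (vals v)) _ u
  simp only [e, h.jacobiator_output_cons, unshuffleSum_add, h.sum_not_nested, add_zero]
  exact unshuffleSum_assoc Letter.deg
    (fun a b v => q (q (q (vals a) :: vals b) :: vals v)) w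

end GradedBrackets

end Brackets

/-! ### Multilinearity in letters of fixed degree. -/

section Multilinear

variable {O : Type uO} {E : ℕ → Type uE} [CommRing O] [∀ n, AddCommGroup (E n)]
  [∀ n, Module O (E n)] {N : Type*} [AddCommGroup N] [Module O N]

/-- A function of words of homogeneous elements is multilinear if it is linear in every letter
of given degree. -/
structure LetterMultilinear (O : Type uO) [CommRing O] [∀ n, Module O (E n)] [Module O N]
    (φ : List (Letter E) → N) : Prop where
  add : ∀ (u v : List (Letter E)) (a b c : Letter E), a.deg = c.deg → b.deg = c.deg →
    c.val = a.val + b.val → φ (u ++ c :: v) = φ (u ++ a :: v) + φ (u ++ b :: v)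
  smul : ∀ (u v : List (Letter E)) (f : O) (a c : Letter E), a.deg = c.deg →
    c.val = f • a.val → φ (u ++ c :: v) = f • φ (u ++ a :: v)

lemma units_smul_smul_comm (s : ℤˣ) (f : O) (x : N) : s • f • x = f • s • x := by
  rw [Units.smul_def, Units.smul_def, smul_comm]

lemma WordMultilinear.letterMultilinear {q : List (⨁ n, E n) → N} (h : WordMultilinear O q) :
    LetterMultilinear O fun w : List (Letter E) => q (vals w) where
  add u v a b c _ _ hc := by simp [hc, h.add]
  smul u v f a c _ hc := by simp [hc, h.smul]

/-- Moving a letter to the front costs a sign depending on degrees only, so linearity in the first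
letter is enough. -/
lemma GradedSymmetric.letterMultilinear {φ : List (Letter E) → N}
    (h : GradedSymmetric Letter.deg φ)
    (hadd : ∀ (v : List (Letter E)) (a b c : Letter E), a.deg = c.deg → b.deg = c.deg →
      c.val = a.val + b.val → φ (c :: v) = φ (a :: v) + φ (b :: v))
    (hsmul : ∀ (v : List (Letter E)) (f : O) (a c : Letter E), a.deg = c.deg →
      c.val = f • a.val → φ (c :: v) = f • φ (a :: v)) :
    LetterMultilinear O φ where
  add u v a b c ha hb hc := by
    rw [h.move, h.move _ u v a, h.move _ u v b, hadd _ a b c ha hb hc, smul_add, ha, hb]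
  smul u v f a c ha hc := by
    rw [h.move, h.move _ u v a, hsmul _ f a c ha hc, ha, units_smul_smul_comm]

end Multilinear

/-! ### The total complex, almost algebroids, and tensoriality of the Jacobiator. -/

section Resolution

variable {K : Type uK} {O : Type uO} {A : Type uA} {E : ℕ → Type uE}
  [Field K] [CommRing O]
  [∀ n, AddCommGroup (E n)] [∀ n, Module O (E n)]

namespace FreeResolution

section

variable [AddCommGroup A] [Module O A] (R : FreeResolution O A E)

/-- The differential on the total space. -/
def totalDiff : (⨁ n, E n) →ₗ[O] ⨁ n, E n :=
  DirectSum.toModule O ℕ _ fun n => match n with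
    | 0 => 0
    | n + 1 => DirectSum.lof O ℕ E n ∘ₗ R.d n

lemma totalDiff_of_zero (x : E 0) : R.totalDiff (DirectSum.of E 0 x) = 0 := by
  rw [totalDiff, ← DirectSum.lof_eq_of O, DirectSum.toModule_lof, LinearMap.zero_apply]

lemma totalDiff_of_succ (n : ℕ) (x : E (n + 1)) :
    R.totalDiff (DirectSum.of E (n + 1) x) = DirectSum.of E n (R.d n x) := by
  rw [totalDiff, ← DirectSum.lof_eq_of O, DirectSum.toModule_lof, LinearMap.comp_apply,
    DirectSum.lof_eq_of]

lemma totalDiff_apply (v : ⨁ n, E n) (n : ℕ) : R.totalDiff v n = R.d n (v (n + 1)) := by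
  induction v using DirectSum.induction_on with
  | zero => simp
  | add x y hx hy => rw [map_add, DirectSum.add_apply, DirectSum.add_apply, map_add, hx, hy]
  | of i x =>
    cases i with
    | zero =>
      rw [totalDiff_of_zero, DirectSum.of_eq_of_ne _ _ _ (by omega), map_zero,
        DirectSum.zero_apply]
    | succ i =>
      rw [totalDiff_of_succ]
      by_cases h : n = i
      · subst h
        rw [DirectSum.of_eq_same, DirectSum.of_eq_same]
      · rw [DirectSum.of_eq_of_ne _ _ _ h, DirectSum.of_eq_of_ne _ _ _ (by omega), map_zero]

lemma totalDiff_totalDiff (v : ⨁ n, E n) : R.totalDiff (R.totalDiff v) = 0 := by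
  ext n
  rw [totalDiff_apply, totalDiff_apply, (R.exact_d n).apply_apply_eq_zero, DirectSum.zero_apply]

/-- The augmentation, extended by zero to the total space. -/
def totalAug : (⨁ n, E n) →ₗ[O] A := R.aug ∘ₗ DirectSum.component O ℕ E 0

lemma totalAug_apply (v : ⨁ n, E n) : R.totalAug v = R.aug (v 0) := rfl

lemma totalAug_totalDiff (v : ⨁ n, E n) : R.totalAug (R.totalDiff v) = 0 := by
  rw [totalAug_apply, totalDiff_apply, R.exact_aug.apply_apply_eq_zero]

lemma totalAug_eq_zero {m : ℤ} (hm : m ≠ -1) {v : ⨁ n, E n} (hv : IsHomogeneousOfDegree m v) :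
    R.totalAug v = 0 := by
  rw [totalAug_apply, hv 0 (by simpa using hm.symm), map_zero]

/-- Exactness of the total complex in one degree. -/
lemma exists_totalDiff_eq {m : ℤ} {v : ⨁ n, E n} (hm : m < 0) (hv : IsHomogeneousOfDegree m v)
    (haug : R.totalAug v = 0) (hd : R.totalDiff v = 0) :
    ∃ y, IsHomogeneousOfDegree (m - 1) y ∧ R.totalDiff y = v := by
  obtain ⟨n, rfl⟩ : ∃ n : ℕ, m = -((n : ℤ) + 1) := ⟨(-m - 1).toNat, by omega⟩
  have hv' := LieInftyAlgebroid.eq_of_isHomogeneous rfl hv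
  have hy : ∃ y, R.d n y = v n := by
    cases n with
    | zero => exact (R.exact_aug _).1 haug
    | succ n =>
      refine (R.exact_d n _).1 ?_
      rw [← totalDiff_apply, hd, DirectSum.zero_apply]
  obtain ⟨y, hy⟩ := hy
  refine ⟨DirectSum.of E (n + 1) y, ?_, ?_⟩
  · convert LieInftyAlgebroid.isHomogeneous_of (n + 1) y using 1
    push_cast
    ring
  · rw [totalDiff_of_succ, hy, ← hv']

end

end FreeResolution

variable [LieRing A] [Module O A] [LieRingModule A O] {R : FreeResolution O A E}

/-- The action of words on `O`: a word of length one acts by its anchor, other words by zero. -/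
def wordAnchor (R : FreeResolution O A E) (u : List (Letter E)) (f : O) : O :=
  match u with
  | [y] => ⁅R.totalAug y.val, f⁆
  | _ => 0

lemma wordAnchor_singleton (y : Letter E) (f : O) :
    wordAnchor R [y] f = ⁅R.totalAug y.val, f⁆ := rfl

lemma wordAnchor_of_length {u : List (Letter E)} (hu : u.length ≠ 1) (f : O) :
    wordAnchor R u f = 0 := by
  match u, hu with
  | [], _ => rfl
  | [y], hu => simp at hu
  | _ :: _ :: _, _ => rfl

lemma wordAnchor_of_degree {u : List (Letter E)} (hu : wordDegree Letter.deg u ≠ -1) (f : O) :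
    wordAnchor R u f = 0 := by
  match u, hu with
  | [], _ => rfl
  | [y], hu =>
    rw [wordAnchor_singleton, R.totalAug_eq_zero (by simpa using hu) y.homog, zero_lie]
  | _ :: _ :: _, _ => rfl

variable [∀ n, Module K (E n)]

/-- Brackets that have all the properties required of a Lie `∞`-algebroid covering `A`, the higher
Jacobi identities excepted. -/
structure AlmostAlgebroid (K : Type uK) [Field K] [∀ n, Module K (E n)]
    (R : FreeResolution O A E) (q : List (⨁ n, E n) → ⨁ n, E n) : Prop
    extends GradedBrackets K q where
  unary : ∀ x, q [x] = R.totalDiff x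
  smul_of_length : ∀ u v (f : O) a, u.length + v.length ≠ 1 →
    q (u ++ (f • a) :: v) = f • q (u ++ a :: v)
  leibniz : ∀ x y (f : O), q [x, f • y] = ⁅R.totalAug x, f⁆ • y + f • q [x, y]
  aug_binary : ∀ x y, R.totalAug (q [x, y]) = ⁅R.totalAug x, R.totalAug y⁆
  aug_eq_zero : ∀ l, l.length ≠ 2 → R.totalAug (q l) = 0

namespace AlmostAlgebroid

variable {q : List (⨁ n, E n) → ⨁ n, E n}

/-- The augmented Jacobiator is the Jacobiator of `A`. -/
lemma aug_jacobiator (h : AlmostAlgebroid K R q) (w : List (Letter E)) :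
    R.totalAug (jacobiator q w) = 0 := by
  have e := map_unshuffleSum Letter.deg R.totalAug.toAddMonoidHom
    (fun u v => q (q (vals u) :: vals v)) w
  simp only [LinearMap.toAddMonoidHom_coe] at e
  rw [jacobiator, e]
  by_cases hw : w.length = 3
  · obtain ⟨x, y, z, rfl⟩ := List.length_eq_three.1 hw
    simp only [unshuffleSum_cons, unshuffleSum_nil, vals_cons, vals_nil, wordDegree_cons,
      wordDegree_nil, h.aug_binary]
    have e0 : ∀ x y z, R.totalAug (q [x, y, z]) = 0 := fun x y z => h.aug_eq_zero _ (by simp)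
    have e1 : ∀ x, R.totalAug (q [x]) = 0 := fun x => h.aug_eq_zero _ (by simp)
    have e4 : ∀ x y z t, R.totalAug (q [x, y, z, t]) = 0 :=
      fun x y z t => h.aug_eq_zero _ (by simp)
    simp only [e0, e1, e4, smul_zero, add_zero, zero_add]
    -- The augmentation kills letters of degree other than `-1`; for three letters of degree `-1`
    -- the sum is the Jacobi identity of `A`.
    by_cases hx : x.deg = -1
    · by_cases hy : y.deg = -1
      · by_cases hz : z.deg = -1
        · have s1 : Int.negOnePow 1 = -1 := rfl
          have s2 : Int.negOnePow 2 = 1 := rfl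
          norm_num [hx, hy, hz, s1, s2]
          simp only [← lie_skew (R.totalAug z.val) (R.totalAug y.val),
            ← lie_skew (R.totalAug z.val) (R.totalAug x.val),
            ← lie_skew (R.totalAug y.val) (R.totalAug x.val), lie_neg]
          have j : ⁅R.totalAug z.val, ⁅R.totalAug x.val, R.totalAug y.val⁆⁆ =
              ⁅R.totalAug y.val, ⁅R.totalAug x.val, R.totalAug z.val⁆⁆ -
                ⁅R.totalAug x.val, ⁅R.totalAug y.val, R.totalAug z.val⁆⁆ := by
            rw [← lie_skew, lie_lie, neg_sub]
          rw [j]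
          abel
        · simp [R.totalAug_eq_zero hz z.homog]
      · simp [R.totalAug_eq_zero hy y.homog]
    · simp [R.totalAug_eq_zero hx x.homog]
  · refine unshuffleSum_eq_zero _ fun u v huv => ?_
    have hl := huv.length_eq
    rw [List.length_append] at hl
    -- A binary outer bracket forces an inner bracket of arity different from two here, and the
    -- augmentation of the latter is zero.
    by_cases hv : v.length = 1
    · obtain ⟨b, rfl⟩ := List.length_eq_one_iff.1 hv
      simp only [vals_cons, vals_nil]
      rw [h.aug_binary, h.aug_eq_zero _ (by rw [length_vals]; simp at hl; omega), zero_lie]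
    · exact h.aug_eq_zero _ (by simpa using hv)

/-- The Leibniz rule carried to the first argument by graded symmetry. The term with `wordAnchor` is
nonzero only in the binary case with `|y| = -1`, where the two transposition signs leave
`(-1)^{|x|}`. -/
lemma smul_head (h : AlmostAlgebroid K R q) (x : Letter E) (u : List (Letter E)) (f : O) :
    q ((f • x.val) :: vals u) =
      f • q (x.val :: vals u) + x.deg.negOnePow • wordAnchor R u f • x.val := by
  by_cases hu : u.length = 1
  · obtain ⟨y, rfl⟩ := List.length_eq_one_iff.1 hu
    have hfx : IsHomogeneousOfDegree x.deg (f • x.val) := fun n hn => by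
      rw [DirectSum.smul_apply, x.homog n hn, smul_zero]
    have e1 := h.symm_head ⟨x.deg, f • x.val, hfx⟩ y []
    have e2 := h.symm_head x y []
    simp only [vals_nil] at e1 e2
    simp only [vals_cons, vals_nil, wordAnchor_singleton]
    rw [e1, e2, h.leibniz, smul_add, add_comm, units_smul_smul_comm]
    congr 1
    by_cases hy : y.deg = -1
    · rw [hy, mul_neg_one, Int.negOnePow_neg]
    · rw [R.totalAug_eq_zero hy y.homog, zero_lie, zero_smul, smul_zero, smul_zero]
  · rw [wordAnchor_of_length hu, zero_smul, smul_zero, add_zero]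
    exact h.smul_of_length [] _ f _ (by simpa using hu)

lemma jacobiator_add_head (h : AlmostAlgebroid K R q) (w : List (Letter E)) (a b c : Letter E)
    (ha : a.deg = c.deg) (hb : b.deg = c.deg) (hc : c.val = a.val + b.val) :
    jacobiator q (c :: w) = jacobiator q (a :: w) + jacobiator q (b :: w) := by
  simp only [jacobiator, unshuffleSum_cons, vals_cons, hc, ha, hb, h.add_head]
  have e : ∀ u v : List (⨁ n, E n), q (q u :: (a.val + b.val) :: v) =
      q (q u :: a.val :: v) + q (q u :: b.val :: v) :=
    fun u v => h.multilinear.add [q u] v a.val b.val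
  simp only [e, smul_add, unshuffleSum_add]
  abel

/-- Two applications of the Leibniz rule, one in each bracket, produce two first-order terms and one
second-order term in `f`. -/
lemma nested_smul (h : AlmostAlgebroid K R q) (x : Letter E) (f : O) (u v : List (Letter E)) :
    q (q ((f • x.val) :: vals u) :: vals v) = f • q (q (x.val :: vals u) :: vals v) +
      ((x.deg + wordDegree Letter.deg u + 1).negOnePow • wordAnchor R v f • q (x.val :: vals u) +
        x.deg.negOnePow • wordAnchor R u f • q (x.val :: vals v)) +
      wordAnchor R v (wordAnchor R u f) • x.val := by
  have e := map_zsmul (h.headHom (vals v)) (x.deg.negOnePow : ℤ) (wordAnchor R u f • x.val)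
  have e' : q ((x.deg.negOnePow • wordAnchor R u f • x.val) :: vals v) =
    x.deg.negOnePow • q ((wordAnchor R u f • x.val) :: vals v) := e
  have e2 := h.smul_head (h.output (x :: u)) v f
  simp only [GradedBrackets.output_val, GradedBrackets.output_deg, vals_cons,
    wordDegree_cons] at e2
  rw [h.smul_head, h.add_head, e', h.smul_head x v, e2, smul_add, smul_smul, ← Int.negOnePow_add,
    Int.negOnePow_even (x.deg + x.deg) ⟨_, rfl⟩, one_smul]
  abel

/-- The outer bracket is binary only for empty `v`. Its anchor term then survives only if `q (vals
u)` has degree `-1`, so `|u| = -2` and the sign is trivial. -/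
lemma not_nested_smul (h : AlmostAlgebroid K R q) (x : Letter E) (f : O)
    (u v : List (Letter E)) :
    (x.deg * wordDegree Letter.deg u).negOnePow • q (q (vals u) :: (f • x.val) :: vals v) =
      f • (x.deg * wordDegree Letter.deg u).negOnePow • q (q (vals u) :: x.val :: vals v) +
        if v = [] then ⁅R.totalAug (q (vals u)), f⁆ • x.val else 0 := by
  rw [← units_smul_smul_comm]
  split_ifs with hv
  · subst hv
    rw [vals_nil, h.leibniz, smul_add, add_comm]
    congr 1
    by_cases hu : wordDegree Letter.deg u + 1 = -1
    · rw [show wordDegree Letter.deg u = -2 by omega, Int.negOnePow_even _ ⟨-x.deg, by ring⟩,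
        one_smul]
    · rw [R.totalAug_eq_zero hu (h.homog u), zero_lie, zero_smul, smul_zero]
  · rw [add_zero]
    congr 1
    refine h.smul_of_length [q (vals u)] (vals v) f x.val ?_
    simpa using hv

/-- For two letters of degree `-1` this is the morphism property of the anchor, `ρ(y)ρ(x) - ρ(x)ρ(y)
+ ρ([x,y]) = 0`; in all other cases every term vanishes. -/
lemma sum_wordAnchor (h : AlmostAlgebroid K R q) (w : List (Letter E)) (f : O)
    (z : ⨁ n, E n) :
    unshuffleSum Letter.deg (fun u v => wordAnchor R v (wordAnchor R u f) • z) w +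
      ⁅R.totalAug (q (vals w)), f⁆ • z = 0 := by
  by_cases hw : w.length = 2
  · obtain ⟨x, y, rfl⟩ := List.length_eq_two.1 hw
    simp only [unshuffleSum_cons, unshuffleSum_nil, vals_cons, vals_nil, wordDegree_cons,
      wordDegree_nil, h.aug_binary]
    by_cases hx : x.deg = -1
    · by_cases hy : y.deg = -1
      · have s1 : Int.negOnePow 1 = -1 := rfl
        norm_num [hx, hy, s1, wordAnchor, sub_smul]
        abel
      · simp [wordAnchor, R.totalAug_eq_zero hy y.homog]
    · simp [wordAnchor, R.totalAug_eq_zero hx x.homog]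
  · rw [h.aug_eq_zero _ (by simpa using hw), zero_lie, zero_smul, add_zero]
    refine unshuffleSum_eq_zero _ fun u v huv => ?_
    have hl := huv.length_eq
    rw [List.length_append] at hl
    by_cases hv : v.length = 1
    · rw [wordAnchor_of_length (u := u) (by omega)]
      obtain ⟨b, rfl⟩ := List.length_eq_one_iff.1 hv
      simp [wordAnchor]
    · rw [wordAnchor_of_length hv, zero_smul]

/-- The two families of first-order terms become opposite after the subwords are interchanged. Only
words `v` of degree `-1` have a nonzero anchor, and this fixes the parity. -/
lemma sum_anchor_terms (x : Letter E) (f : O)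
    (w : List (Letter E)) :
    unshuffleSum Letter.deg (fun u v =>
      (x.deg + wordDegree Letter.deg u + 1).negOnePow • wordAnchor R v f • q (x.val :: vals u) +
        x.deg.negOnePow • wordAnchor R u f • q (x.val :: vals v)) w = 0 := by
  rw [unshuffleSum_add, unshuffleSum_comm Letter.deg
    (fun u v => x.deg.negOnePow • wordAnchor R u f • q (x.val :: vals v)), ← unshuffleSum_add]
  refine unshuffleSum_eq_zero _ fun u v _ => ?_
  by_cases hv : wordDegree Letter.deg v = -1
  · rw [hv, smul_smul, ← Int.negOnePow_add, Int.negOnePow_succ,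
      negOnePow_congr (m := wordDegree Letter.deg u * -1 + x.deg)
        (n := x.deg + wordDegree Letter.deg u) (-wordDegree Letter.deg u) (by ring),
      Units.neg_smul, neg_add_cancel]
  · simp [wordAnchor_of_degree hv]

/-- All anchor terms cancel: those of first order by `sum_anchor_terms`, those of second order
against the term that is not nested by `sum_wordAnchor`. Hence the Jacobiator can be corrected on a
basis. -/
lemma jacobiator_smul_head (h : AlmostAlgebroid K R q) (w : List (Letter E)) (f : O)
    (a c : Letter E) (ha : a.deg = c.deg) (hc : c.val = f • a.val) :
    jacobiator q (c :: w) = f • jacobiator q (a :: w) := by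
  simp only [jacobiator, unshuffleSum_cons, vals_cons, hc, ← ha, h.nested_smul,
    h.not_nested_smul]
  rw [unshuffleSum_add, unshuffleSum_add, sum_anchor_terms, unshuffleSum_add, unshuffleSum_smul,
    unshuffleSum_smul, unshuffleSum_right_nil Letter.deg
      (fun u => ⁅R.totalAug (q (vals u)), f⁆ • a.val), add_zero, smul_add,
    add_add_add_comm, h.sum_wordAnchor, add_zero]

lemma jacobiator_multilinear [CharZero K] (h : AlmostAlgebroid K R q) :
    LetterMultilinear O (jacobiator (E := E) q) :=
  h.jacobiator_symm.letterMultilinear h.jacobiator_add_head h.jacobiator_smul_head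

end AlmostAlgebroid

end Resolution

/-! ### Koszul signs of permutations, and unshuffles as shuffle permutations. -/

section KoszulSign

variable {k : ℕ}

/-- For symmetric `f` this is a product over unordered pairs, which `τ` merely permutes. -/
lemma prod_lt_comp_perm {M : Type*} [CommMonoid M] (τ : Equiv.Perm (Fin k))
    (f : Fin k → Fin k → M) (hf : ∀ a b, f a b = f b a) :
    ∏ p : Fin k × Fin k with p.1 < p.2, f (τ p.1) (τ p.2) =
      ∏ p : Fin k × Fin k with p.1 < p.2, f p.1 p.2 := by
  have key : ∀ (τ : Equiv.Perm (Fin k)) (p : Fin k × Fin k), p.1 < p.2 →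
      ((if τ p.1 < τ p.2 then (τ p.1, τ p.2) else (τ p.2, τ p.1)) : Fin k × Fin k).1 <
      ((if τ p.1 < τ p.2 then (τ p.1, τ p.2) else (τ p.2, τ p.1)) : Fin k × Fin k).2 := by
    intro τ p hp
    split_ifs with h
    · exact h
    · exact lt_of_le_of_ne (not_lt.1 h) fun e => hp.ne (τ.injective e).symm
  refine Finset.prod_nbij' (fun p => if τ p.1 < τ p.2 then (τ p.1, τ p.2) else (τ p.2, τ p.1))
    (fun p => if τ⁻¹ p.1 < τ⁻¹ p.2 then (τ⁻¹ p.1, τ⁻¹ p.2) else (τ⁻¹ p.2, τ⁻¹ p.1)) ?_ ?_ ?_ ?_ ?_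
  · intro p hp
    exact Finset.mem_filter.2 ⟨Finset.mem_univ _, key τ p (by simpa using hp)⟩
  · intro p hp
    exact Finset.mem_filter.2 ⟨Finset.mem_univ _, key τ⁻¹ p (by simpa using hp)⟩
  · intro p hp
    have hp' : p.1 < p.2 := by simpa using hp
    split_ifs with h1 h2 h2 <;> simp_all [not_lt_of_gt]
  · intro p hp
    have hp' : p.1 < p.2 := by simpa using hp
    split_ifs with h1 h2 h2 <;> simp_all [not_lt_of_gt]
  · intro p hp
    split_ifs with h
    · rfl
    · exact hf _ _

lemma koszulSign_eq_prod (deg : Fin k → ℤ) (σ : Equiv.Perm (Fin k)) :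
    koszulSign deg σ = ∏ p : Fin k × Fin k with p.1 < p.2,
      if σ p.2 < σ p.1 then (deg (σ p.1) * deg (σ p.2)).negOnePow else 1 := by
  rw [koszulSign, ← Finset.filter_filter, Finset.prod_filter]

/-- Cocycle rule: a pair is inverted by `σ * τ` exactly when one, but not both, of `τ` on the pair
and `σ` on its image inverts it; a double inversion contributes the square of a sign. -/
lemma koszulSign_mul (deg : Fin k → ℤ) (σ τ : Equiv.Perm (Fin k)) :
    koszulSign deg (σ * τ) = koszulSign deg σ * koszulSign (deg ∘ σ) τ := by
  -- The inversion factor of `σ` is symmetrised, so that its product can be reindexed by `τ`.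
  let F : Fin k → Fin k → ℤˣ := fun a b => if (a < b ∧ σ b < σ a) ∨ (b < a ∧ σ a < σ b) then
    (deg (σ a) * deg (σ b)).negOnePow else 1
  have e : koszulSign deg σ = ∏ p : Fin k × Fin k with p.1 < p.2, F p.1 p.2 := by
    rw [koszulSign_eq_prod]
    refine Finset.prod_congr rfl fun p hp => ?_
    have hp' : p.1 < p.2 := by simpa using hp
    simp [F, hp', not_lt_of_gt hp']
  rw [e, ← prod_lt_comp_perm τ F (fun a b => by simp only [F, or_comm, mul_comm]),
    koszulSign_eq_prod, koszulSign_eq_prod, ← Finset.prod_mul_distrib]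
  refine Finset.prod_congr rfl fun p hp => ?_
  have hp' : p.1 < p.2 := by simpa using hp
  have h1 : τ p.1 ≠ τ p.2 := fun e => hp'.ne (τ.injective e)
  have h2 : σ (τ p.1) ≠ σ (τ p.2) := fun e => h1 (σ.injective e)
  simp only [F, Equiv.Perm.mul_apply, Function.comp_apply]
  rcases lt_or_gt_of_ne h1 with h1 | h1 <;> rcases lt_or_gt_of_ne h2 with h2 | h2 <;>
    simp [h1, h2, not_lt_of_gt h1, not_lt_of_gt h2]

lemma koszulSign_one (deg : Fin k → ℤ) : koszulSign deg 1 = 1 := by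
  rw [koszulSign_eq_prod]
  refine Finset.prod_eq_one fun p hp => ?_
  have hp' : p.1 < p.2 := by simpa using hp
  simp [not_lt_of_gt hp']

lemma koszulSign_swap (deg : Fin (k + 1) → ℤ) (i : Fin k) :
    koszulSign deg (Equiv.swap i.castSucc i.succ) =
      (deg i.castSucc * deg i.succ).negOnePow := by
  rw [koszulSign, Finset.prod_eq_single_of_mem (i.castSucc, i.succ)]
  · simp [mul_comm]
  · simp
  · rintro ⟨a, b⟩ hab hne
    exfalso
    simp only [Finset.mem_filter, Finset.mem_univ, true_and] at hab
    apply hne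
    obtain ⟨h1, h2⟩ := hab
    simp only [Equiv.swap_apply_def, Fin.ext_iff, Fin.val_castSucc, Fin.val_succ] at h2
    simp only [Prod.mk.injEq, Fin.ext_iff, Fin.val_castSucc, Fin.val_succ]
    rw [Fin.lt_def] at h1 h2
    split_ifs at h2 <;> (try simp only [Fin.val_castSucc, Fin.val_succ] at h2) <;> omega

variable {α M : Type*} [AddCommGroup M] (deg : α → ℤ)

lemma List.ofFn_eq_insert {n : ℕ} (x : Fin (n + 1) → α) (p : Fin (n + 1)) :
    List.ofFn x = (List.ofFn fun i => x (p.succAbove i)).take p ++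
      x p :: (List.ofFn fun i => x (p.succAbove i)).drop p := by
  refine List.ext_getElem ?_ fun i h1 h2 => ?_
  · simp only [List.length_ofFn, List.length_append, List.length_take, List.length_cons,
      List.length_drop]
    omega
  · simp only [List.getElem_append, List.getElem_cons, List.length_take, List.length_ofFn,
      List.getElem_take, List.getElem_drop, List.getElem_ofFn]
    simp only [List.length_ofFn] at h1
    split_ifs with h3 h4
    · congr 1
      ext
      rw [Fin.succAbove_of_castSucc_lt _ _ (Fin.lt_def.2 (by simp; omega))]
      rfl
    · congr 1
      ext
      simp only
      omega
    · congr 1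
      ext
      rw [Fin.succAbove_of_le_castSucc _ _ (Fin.le_def.2 (by simp only [Fin.val_castSucc]; omega))]
      simp only [Fin.val_succ]
      omega

lemma List.ofFn_eq_of_eq_off_pair {n : ℕ} (x z : Fin (n + 1) → α) (i : Fin n)
    (h : ∀ j, j ≠ i.castSucc → j ≠ i.succ → z j = x j) :
    List.ofFn z = (List.ofFn x).take i ++
      z i.castSucc :: z i.succ :: (List.ofFn x).drop (i + 2) := by
  refine List.ext_getElem ?_ fun j h1 h2 => ?_
  · simp only [List.length_ofFn, List.length_append, List.length_take, List.length_cons,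
      List.length_drop]
    omega
  · simp only [List.getElem_append, List.getElem_cons, List.length_take, List.length_ofFn,
      List.getElem_take, List.getElem_drop, List.getElem_ofFn]
    simp only [List.length_ofFn] at h1
    split_ifs
    · rw [h]
      all_goals simp only [ne_eq, Fin.ext_iff, Fin.val_castSucc, Fin.val_succ]; omega
    · congr 1; ext; simp only [Fin.val_castSucc]; omega
    · congr 1; ext; simp only [Fin.val_succ]; omega
    · rw [h]
      · congr 1; ext; simp only; omega
      all_goals simp only [ne_eq, Fin.ext_iff, Fin.val_castSucc, Fin.val_succ]; omega

/-- Adjacent transpositions generate the symmetric group, and the signs compose by the cocycle rule.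
-/
lemma GradedSymmetric.perm {φ : List α → M} (h : GradedSymmetric deg φ) {n : ℕ}
    (x : Fin n → α) (σ : Equiv.Perm (Fin n)) :
    φ (List.ofFn fun i => x (σ i)) =
      koszulSign (fun i => deg (x i)) σ • φ (List.ofFn x) := by
  cases n with
  | zero => rw [Subsingleton.elim σ 1, koszulSign_one, one_smul]; rfl
  | succ n =>
    have hσ : σ ∈ Submonoid.closure
        (Set.range fun i : Fin n => Equiv.swap i.castSucc i.succ) := by
      rw [Equiv.Perm.mclosure_swap_castSucc_succ]
      trivial
    induction hσ using Submonoid.closure_induction generalizing x with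
    | one => rw [koszulSign_one, one_smul]; rfl
    | mul σ τ _ _ hσ hτ =>
      rw [koszulSign_mul, mul_comm, mul_smul, ← hσ]
      exact hτ fun i => x (σ i)
    | mem σ hσ =>
      obtain ⟨i, rfl⟩ := hσ
      rw [koszulSign_swap, List.ofFn_eq_of_eq_off_pair x x i fun _ _ _ => rfl,
        List.ofFn_eq_of_eq_off_pair x (fun j => x (Equiv.swap i.castSucc i.succ j)) i
          fun j h1 h2 => by rw [Equiv.swap_apply_of_ne_of_ne h1 h2],
        Equiv.swap_apply_left, Equiv.swap_apply_right, h, mul_comm]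

/-- The permutation fixes `0`, which therefore takes part in no inversion. -/
lemma koszulSign_decomposeFin {n : ℕ} (d : Fin (n + 1) → ℤ) (τ : Equiv.Perm (Fin n)) :
    koszulSign d (Equiv.Perm.decomposeFin.symm (0, τ)) = koszulSign (fun i => d i.succ) τ := by
  rw [koszulSign, koszulSign]
  symm
  refine Finset.prod_bij (fun p _ => (p.1.succ, p.2.succ)) ?_ ?_ ?_ ?_
  · rintro ⟨a, b⟩ h
    simpa using h
  · rintro ⟨a, b⟩ _ ⟨a', b'⟩ _ h
    simpa using h
  · rintro ⟨a, b⟩ h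
    simp only [Finset.mem_filter, Finset.mem_univ, true_and] at h
    induction a using Fin.cases with
    | zero => simp at h
    | succ a =>
      induction b using Fin.cases with
      | zero => simp at h
      | succ b => exact ⟨(a, b), by simpa using h, rfl⟩
  · rintro ⟨a, b⟩ _
    simp

/-- The cycle puts letter `0` in position `p` and keeps the order of the others, so the inversions
are the pairs `(i, p)` with `i < p`. -/
lemma koszulSign_cycleRange {n : ℕ} (d : Fin (n + 1) → ℤ) (p : Fin (n + 1)) :
    koszulSign d p.cycleRange =
      (d 0 * ∑ i : Fin n with i.val < p.val, d i.succ).negOnePow := by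
  have e : ∀ s : Finset (Fin n), (d 0 * ∑ i ∈ s, d i.succ).negOnePow =
      ∏ i ∈ s, (d i.succ * d 0).negOnePow := by
    intro s
    induction s using Finset.cons_induction with
    | empty => simp
    | cons a s ha ih =>
      rw [Finset.sum_cons, Finset.prod_cons, ← ih, mul_add, Int.negOnePow_add, mul_comm (d 0)]
  rw [e, koszulSign]
  symm
  refine Finset.prod_bij (fun i _ => (p.succAbove i, p)) ?_ ?_ ?_ ?_
  · intro i hi
    simp only [Finset.mem_filter, Finset.mem_univ, true_and] at hi ⊢
    rw [Fin.cycleRange_self, Fin.cycleRange_succAbove]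
    exact ⟨Fin.succAbove_lt_iff_castSucc_lt _ _ |>.2 hi, Fin.succ_pos i⟩
  · intro i _ j _ h
    simpa using h
  · rintro ⟨a, b⟩ h
    simp only [Finset.mem_filter, Finset.mem_univ, true_and] at h
    rcases Fin.eq_self_or_eq_succAbove p b with rfl | ⟨b, rfl⟩
    · rcases Fin.eq_self_or_eq_succAbove b a with rfl | ⟨a, rfl⟩
      · simp at h
      · refine ⟨a, ?_, rfl⟩
        have := (Fin.succAbove_lt_iff_castSucc_lt _ _).1 h.1
        simpa [Fin.lt_def] using this
    · rcases Fin.eq_self_or_eq_succAbove p a with rfl | ⟨a, rfl⟩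
      · simp at h
      · rw [Fin.cycleRange_succAbove, Fin.cycleRange_succAbove] at h
        have h1 := (Fin.strictMono_succAbove p).lt_iff_lt.1 h.1
        exact absurd (Fin.succ_lt_succ_iff.1 h.2) (not_lt_of_gt h1)
  · intro i _
    simp

lemma mem_shuffles {p n : ℕ} {σ : Equiv.Perm (Fin n)} : σ ∈ shuffles p n ↔
    ∀ a b : Fin n, a < b → ((b : ℕ) < p ∨ p ≤ (a : ℕ)) → σ a < σ b := by
  simp [shuffles]

/-- The shuffles with letter `0` at the head of the first block: the first branch of the recursion
of `unshuffleSum`. -/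
lemma decomposeFin_mem_shuffles {p n : ℕ} {τ : Equiv.Perm (Fin n)} :
    Equiv.Perm.decomposeFin.symm (0, τ) ∈ shuffles (p + 1) (n + 1) ↔ τ ∈ shuffles p n := by
  rw [mem_shuffles, mem_shuffles]
  constructor
  · intro h a b hab hp
    simpa using h a.succ b.succ (by simpa using hab) (by simpa using hp)
  · intro h a b hab hp
    induction b using Fin.cases with
    | zero => simp at hab
    | succ b =>
      induction a using Fin.cases with
      | zero => simp
      | succ a => simpa using h a b (by simpa using hab) (by simpa using hp)

/-- The shuffles with letter `0` in position `p`, at the head of the second block: the other branch.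
-/
lemma decomposeFin_mul_cycleRange_mem_shuffles {n : ℕ} {p : Fin (n + 1)}
    {τ : Equiv.Perm (Fin n)} :
    Equiv.Perm.decomposeFin.symm (0, τ) * p.cycleRange ∈ shuffles p (n + 1) ↔
      τ ∈ shuffles p n := by
  have hs : ∀ i : Fin n, (p.succAbove i : ℕ) = if (i : ℕ) < p then (i : ℕ) else i + 1 := by
    intro i
    simp only [Fin.succAbove, Fin.lt_def, Fin.val_castSucc]
    split_ifs <;> rfl
  rw [mem_shuffles, mem_shuffles]
  constructor
  · intro h a b hab hp
    have := h (p.succAbove a) (p.succAbove b) ((Fin.strictMono_succAbove p) hab) (by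
      rw [hs, hs]
      split_ifs <;> omega)
    simpa using this
  · intro h a b hab hp
    rcases Fin.eq_self_or_eq_succAbove p b with rfl | ⟨b, rfl⟩
    · have := Fin.lt_def.1 hab
      omega
    · rcases Fin.eq_self_or_eq_succAbove p a with rfl | ⟨a, rfl⟩
      · simp
      · have := h a b ((Fin.strictMono_succAbove p).lt_iff_lt.1 hab) (by
          rw [hs, hs] at hp
          split_ifs at hp <;> omega)
        simpa using this

lemma exists_decomposeFin {n : ℕ} {σ : Equiv.Perm (Fin (n + 1))} (h : σ 0 = 0) :
    ∃ τ, Equiv.Perm.decomposeFin.symm (0, τ) = σ := by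
  obtain ⟨⟨p, τ⟩, rfl⟩ := Equiv.Perm.decomposeFin.symm.surjective σ
  rw [Equiv.Perm.decomposeFin_symm_apply_zero] at h
  exact ⟨τ, by rw [h]⟩

lemma decomposeFin_injective {n : ℕ} {σ τ : Equiv.Perm (Fin n)}
    (h : Equiv.Perm.decomposeFin.symm (0, σ) = Equiv.Perm.decomposeFin.symm (0, τ)) : σ = τ :=
  (Prod.mk.inj (Equiv.Perm.decomposeFin.symm.injective h)).2

/-- The sum over all unshuffles, in terms of shuffle permutations. -/
lemma unshuffleSum_ofFn (φ : List α → List α → M) {n : ℕ} (x : Fin n → α) :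
    unshuffleSum deg φ (List.ofFn x) = ∑ p ∈ Finset.range (n + 1), ∑ σ ∈ shuffles p n,
      koszulSign (fun i => deg (x i)) σ • φ ((List.ofFn fun i => x (σ i)).take p)
        ((List.ofFn fun i => x (σ i)).drop p) := by
  induction n generalizing φ with
  | zero =>
    have : shuffles 0 0 = {1} := by decide
    simp [this, koszulSign_one]
  | succ n ih =>
    set T : ℕ → Equiv.Perm (Fin (n + 1)) → M := fun p σ =>
      koszulSign (fun i => deg (x i)) σ • φ ((List.ofFn fun i => x (σ i)).take p)
        ((List.ofFn fun i => x (σ i)).drop p) with hT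
    -- Letter `0` is in the first block exactly when that block is nonempty and `σ 0 = 0`; this
    -- split matches the recursion.
    have hsplit : ∀ p, ∑ σ ∈ shuffles p (n + 1), T p σ =
        ∑ σ ∈ shuffles p (n + 1) with 0 < p ∧ σ 0 = 0, T p σ +
          ∑ σ ∈ shuffles p (n + 1) with ¬ (0 < p ∧ σ 0 = 0), T p σ :=
      fun p => (Finset.sum_filter_add_sum_filter_not _ _ _).symm
    rw [Finset.sum_congr rfl fun p _ => hsplit p, Finset.sum_add_distrib, List.ofFn_succ,
      unshuffleSum_cons, ih, ih]
    congr 1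
    · rw [Finset.sum_range_succ' _ (n + 1)]
      simp only [lt_irrefl, false_and, Finset.filter_false, Finset.sum_empty, add_zero]
      refine Finset.sum_congr rfl fun p _ => ?_
      refine Finset.sum_bij (fun τ _ => Equiv.Perm.decomposeFin.symm (0, τ)) ?_ ?_ ?_ ?_
      · intro τ hτ
        simp [decomposeFin_mem_shuffles, hτ]
      · intro σ _ τ _ h
        exact decomposeFin_injective h
      · intro σ hσ
        simp only [Finset.mem_filter] at hσ
        obtain ⟨τ, rfl⟩ := exists_decomposeFin hσ.2.2
        exact ⟨τ, decomposeFin_mem_shuffles.1 hσ.1, rfl⟩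
      · intro τ _
        simp only [hT, koszulSign_decomposeFin, List.ofFn_succ,
          Equiv.Perm.decomposeFin_symm_apply_zero, Equiv.Perm.decomposeFin_symm_apply_succ,
          Equiv.swap_self, Equiv.refl_apply, List.take_succ_cons, List.drop_succ_cons]
    -- With an empty second block, letter `0` has to be in the first one.
    · have hlast : ∑ σ ∈ shuffles (n + 1) (n + 1) with ¬ (0 < n + 1 ∧ σ 0 = 0),
          T (n + 1) σ = 0 := by
        refine Finset.sum_eq_zero fun σ hσ => ?_
        simp only [Finset.mem_filter, Nat.succ_pos, true_and] at hσ
        exfalso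
        apply hσ.2
        by_contra h0
        have h1 : (0 : Fin (n + 1)) ≠ σ⁻¹ 0 := fun e => h0 (by
          conv_lhs => rw [e]
          simp)
        have := mem_shuffles.1 hσ.1 0 (σ⁻¹ 0) (Fin.pos_iff_ne_zero.2 h1.symm)
          (Or.inl (σ⁻¹ 0).isLt)
        simp at this
      rw [Finset.sum_range_succ _ (n + 1), hlast, add_zero]
      refine Finset.sum_congr rfl fun p hp => ?_
      obtain ⟨p, rfl⟩ : ∃ q : Fin (n + 1), (q : ℕ) = p := ⟨⟨p, by simpa using hp⟩, rfl⟩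
      refine Finset.sum_bij (fun τ _ => Equiv.Perm.decomposeFin.symm (0, τ) * p.cycleRange)
        ?_ ?_ ?_ ?_
      · intro τ hτ
        simp only [Finset.mem_filter, decomposeFin_mul_cycleRange_mem_shuffles, hτ, true_and,
          not_and]
        intro hp e
        rw [Equiv.Perm.mul_apply, Fin.cycleRange_of_lt (Fin.lt_def.2 hp)] at e
        have e2 := Equiv.Perm.decomposeFin_symm_apply_zero 0 τ
        have e3 := congrArg Fin.val (Equiv.injective _ (e.trans e2.symm))
        rw [Fin.val_add_one_of_lt (lt_of_lt_of_le (Fin.lt_def.2 hp) (Fin.le_last p))] at e3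
        simp at e3
      · intro σ _ τ _ h
        exact decomposeFin_injective (mul_right_cancel h)
      · intro σ hσ
        simp only [Finset.mem_filter, not_and] at hσ
        -- The least letter stands at the head of its block, and the head of the first block is
        -- excluded.
        have h0 : σ p = 0 := by
          have hj : σ (σ⁻¹ 0) = 0 := by simp
          rcases lt_trichotomy (σ⁻¹ 0) p with h | h | h
          · exfalso
            by_cases hz : σ⁻¹ 0 = 0
            · rw [hz] at h hj
              exact hσ.2 h hj
            · have := mem_shuffles.1 hσ.1 0 _ (Fin.pos_iff_ne_zero.2 hz) (Or.inl h)
              rw [hj] at this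
              simp at this
          · rw [← h, hj]
          · exfalso
            have := mem_shuffles.1 hσ.1 p _ h (Or.inr le_rfl)
            rw [hj] at this
            simp at this
        obtain ⟨τ, hτ⟩ := exists_decomposeFin (σ := σ * p.cycleRange⁻¹) (by
          rw [Equiv.Perm.mul_apply, Equiv.Perm.inv_def, Fin.cycleRange_symm_zero, h0])
        have hσ' : Equiv.Perm.decomposeFin.symm (0, τ) * p.cycleRange = σ := by
          rw [hτ, inv_mul_cancel_right]
        refine ⟨τ, ?_, hσ'⟩
        rw [← decomposeFin_mul_cycleRange_mem_shuffles, hσ']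
        exact hσ.1
      · intro τ _
        have el := List.ofFn_eq_insert
          (fun i => x ((Equiv.Perm.decomposeFin.symm (0, τ) * p.cycleRange) i)) p
        simp only [Equiv.Perm.mul_apply, Fin.cycleRange_self, Fin.cycleRange_succAbove,
          Equiv.Perm.decomposeFin_symm_apply_zero, Equiv.Perm.decomposeFin_symm_apply_succ,
          Equiv.swap_self, Equiv.refl_apply] at el
        have hl : ((List.ofFn fun i => x (τ i).succ).take p).length = p := by
          simp only [List.length_take, List.length_ofFn]
          omega
        have ed : wordDegree deg ((List.ofFn fun i => x (τ i).succ).take p) =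
            ∑ i : Fin n with i.val < p.val, deg (x (τ i).succ) := by
          rw [wordDegree, List.map_take, List.map_ofFn, List.sum_take_ofFn]
          rfl
        simp only [hT, koszulSign_mul, Equiv.Perm.mul_apply]
        rw [el, List.take_left' hl, List.drop_left' hl, koszulSign_decomposeFin,
          koszulSign_cycleRange, ed, mul_smul]
        simp

end KoszulSign

/-! ### Functions of words from families of multilinear maps. -/

section WordFunctions

variable {O : Type uO} [CommRing O] {M N : Type*} [AddCommGroup M] [Module O M]
  [AddCommGroup N] [Module O N]

/-- The function of words given by a family of multilinear maps. -/
def wordFunction (f : ∀ k, MultilinearMap O (fun _ : Fin k => M) N) (l : List M) : N :=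
  f l.length l.get

lemma wordFunction_ofFn (f : ∀ k, MultilinearMap O (fun _ : Fin k => M) N) {n : ℕ}
    (x : Fin n → M) : wordFunction f (List.ofFn x) = f n x := by
  have key : ∀ (l : List M) (n : ℕ) (h : l.length = n),
      f l.length l.get = f n fun i => l.get (i.cast h.symm) := by
    rintro l _ rfl
    rfl
  rw [wordFunction, key _ n (List.length_ofFn)]
  congr 1
  ext i
  simp

lemma List.exists_append_cons_eq_ofFn {α : Type*} (u v : List α) (a : α) :
    ∃ (n : ℕ) (x : Fin n → α) (i : Fin n),
      ∀ b, u ++ b :: v = List.ofFn (Function.update x i b) := by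
  refine ⟨u.length + v.length + 1, fun j => (u ++ a :: v)[j]'(by simp; omega),
    ⟨u.length, by omega⟩, fun b => List.ext_getElem (by simp; omega) fun i h1 h2 => ?_⟩
  simp only [List.getElem_ofFn, Function.update_apply, Fin.ext_iff, List.getElem_append,
    List.getElem_cons, Fin.getElem_fin]
  split_ifs <;> first | rfl | omega

lemma wordFunction_multilinear (f : ∀ k, MultilinearMap O (fun _ : Fin k => M) N) :
    WordMultilinear O (wordFunction f) where
  add u v a b := by
    obtain ⟨n, x, i, h⟩ := List.exists_append_cons_eq_ofFn u v a
    rw [h, h, h, wordFunction_ofFn, wordFunction_ofFn, wordFunction_ofFn,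
      MultilinearMap.map_update_add]
  smul u v c a := by
    obtain ⟨n, x, i, h⟩ := List.exists_append_cons_eq_ofFn u v a
    rw [h, h, wordFunction_ofFn, wordFunction_ofFn, MultilinearMap.map_update_smul]

lemma List.exists_ofFn_swap {α : Type*} (u v : List α) (a b : α) :
    ∃ (n : ℕ) (x : Fin (n + 1) → α) (i : Fin n), u ++ a :: b :: v = List.ofFn x ∧
      u ++ b :: a :: v = List.ofFn (fun j => x (Equiv.swap i.castSucc i.succ j)) ∧
      x i.castSucc = a ∧ x i.succ = b := by
  let x : Fin (u.length + v.length + 1 + 1) → α :=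
    fun j => (u ++ a :: b :: v)[j]'(by simp; omega)
  have hx : u ++ a :: b :: v = List.ofFn x :=
    List.ext_getElem (by simp; omega) fun i h1 h2 => by
      rw [List.getElem_ofFn (f := x)]
      rfl
  let i : Fin (u.length + v.length + 1) := ⟨u.length, by omega⟩
  have h1 : x i.castSucc = a := by simp [x, i]
  have h2 : x i.succ = b := by simp [x, i]
  refine ⟨_, x, i, hx, ?_, h1, h2⟩
  rw [List.ofFn_eq_of_eq_off_pair x (fun j => x (Equiv.swap i.castSucc i.succ j)) i
    fun j h1 h2 => by rw [Equiv.swap_apply_of_ne_of_ne h1 h2],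
    Equiv.swap_apply_left, Equiv.swap_apply_right, h1, h2, ← hx]
  simp [i]

end WordFunctions

/-! ### A homogeneous basis, and extension from basis words. -/

section Basis

variable {O : Type uO} {A : Type uA} {E : ℕ → Type uE} [CommRing O]
  [∀ n, AddCommGroup (E n)] [∀ n, Module O (E n)] [AddCommGroup A] [Module O A]

lemma homogeneous_smul {m : ℤ} (f : O) {x : ⨁ n, E n} (hx : IsHomogeneousOfDegree m x) :
    IsHomogeneousOfDegree m (f • x) := fun n hn => by
  rw [DirectSum.smul_apply, hx n hn, smul_zero]

/-- An element of `E n` as a letter. -/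
def homogeneousLetter (n : ℕ) (y : E n) : Letter E :=
  ⟨-((n : ℤ) + 1), DirectSum.of E n y, LieInftyAlgebroid.isHomogeneous_of n y⟩

namespace FreeResolution

variable (R : FreeResolution O A E)

/-- A basis of one term of the resolution. -/
noncomputable def termBasis (n : ℕ) :
    Module.Basis (@Module.Free.ChooseBasisIndex O (E n) _ _ _ (R.free n)) O (E n) :=
  @Module.Free.chooseBasis O (E n) _ _ _ (R.free n)

/-- The index set of a homogeneous basis of the total space. -/
abbrev BasisIndex : Type uE :=
  Σ n, @Module.Free.ChooseBasisIndex O (E n) _ _ _ (R.free n)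

/-- A homogeneous basis of the total space. -/
noncomputable def totalBasis : Module.Basis R.BasisIndex O (⨁ n, E n) :=
  DFinsupp.basis R.termBasis

lemma totalBasis_repr (v : ⨁ n, E n) (b : R.BasisIndex) :
    R.totalBasis.repr v b = (R.termBasis b.1).repr (v b.1) b.2 := rfl

lemma totalBasis_apply (b : R.BasisIndex) :
    R.totalBasis b = DirectSum.of E b.1 (R.termBasis b.1 b.2) := by
  rw [Module.Basis.apply_eq_iff]
  ext ⟨m, j⟩
  rw [totalBasis_repr]
  obtain ⟨n, i⟩ := b
  by_cases h : m = n
  · subst h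
    simp [DirectSum.of_eq_same, Finsupp.single_apply]
  · rw [DirectSum.of_eq_of_ne _ _ _ h, map_zero, Finsupp.single_eq_of_ne (by simp [h])]
    rfl

/-- The elements of the homogeneous basis as letters. -/
noncomputable def basisLetter (b : R.BasisIndex) : Letter E :=
  ⟨-((b.1 : ℤ) + 1), R.totalBasis b, by
    rw [totalBasis_apply]
    exact LieInftyAlgebroid.isHomogeneous_of _ _⟩

lemma basisLetter_deg_neg (b : R.BasisIndex) : (R.basisLetter b).deg < 0 := by
  simp only [basisLetter]
  omega

variable {N : Type*} [AddCommGroup N] [Module O N]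

/-- Each degree is handled separately: a letter of degree `≥ 0` has value zero, and one of degree
`-(n + 1)` comes from `E n`, which the basis spans. -/
lemma letter_ext {F : Letter E → N}
    (hadd : ∀ a b c : Letter E, a.deg = c.deg → b.deg = c.deg → c.val = a.val + b.val →
      F c = F a + F b)
    (hsmul : ∀ (f : O) (a c : Letter E), a.deg = c.deg → c.val = f • a.val → F c = f • F a)
    (h : ∀ b, F (R.basisLetter b) = 0) (a : Letter E) : F a = 0 := by
  have hzero : ∀ a : Letter E, a.val = 0 → F a = 0 := fun a ha => by
    rw [hsmul 0 a a rfl (by simp [ha]), zero_smul]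
  obtain ⟨m, x, hx⟩ := a
  by_cases hm : 0 ≤ m
  · exact hzero _ (LieInftyAlgebroid.eq_zero_of_isHomogeneous hm hx)
  · obtain ⟨n, rfl⟩ : ∃ n : ℕ, m = -((n : ℤ) + 1) := ⟨(-m - 1).toNat, by omega⟩
    have key : ∀ y : E n, F (homogeneousLetter n y) = 0 := by
      intro y
      induction (R.termBasis n).mem_span y using Submodule.span_induction with
      | zero => exact hzero _ (map_zero _)
      | mem y hy =>
        obtain ⟨i, rfl⟩ := hy
        rw [← h ⟨n, i⟩]
        simp only [basisLetter, totalBasis_apply, homogeneousLetter]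
      | add y z _ _ hy hz =>
        rw [hadd (homogeneousLetter n y) (homogeneousLetter n z) (homogeneousLetter n (y + z))
          rfl rfl (map_add _ _ _), hy, hz, add_zero]
      | smul f y _ hy =>
        have e : DirectSum.of E n (f • y) = f • DirectSum.of E n y := by
          rw [← DirectSum.lof_eq_of O, map_smul, DirectSum.lof_eq_of]
        rw [hsmul f (homogeneousLetter n y) (homogeneousLetter n (f • y)) rfl e, hy, smul_zero]
    rw [← key (x n)]
    congr 1
    simp only [homogeneousLetter, ← LieInftyAlgebroid.eq_of_isHomogeneous rfl hx]

/-- Besides extending identities from a basis, this disposes of zero letters carrying nonnegative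
formal degrees, for which degree estimates fail. -/
lemma word_ext {φ : List (Letter E) → N} (hφ : LetterMultilinear O φ)
    (h : ∀ l : List R.BasisIndex, φ (l.map R.basisLetter) = 0) (w : List (Letter E)) :
    φ w = 0 := by
  -- Letters are replaced by basis letters from the left; the prefix `l` records those already
  -- replaced.
  have key : ∀ (w : List (Letter E)) (l : List R.BasisIndex),
      φ (l.map R.basisLetter ++ w) = 0 := by
    intro w
    induction w with
    | nil => simpa using h
    | cons a w ih =>
      intro l
      refine R.letter_ext (F := fun a => φ (l.map R.basisLetter ++ a :: w)) (hφ.add _ _)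
        (hφ.smul _ _) (fun b => ?_) a
      simpa using ih (l ++ [b])
  exact key w []

/-- A family of multilinear maps with given values on the basis. -/
noncomputable def multilinearOfBasis (c : ∀ k, (Fin k → R.BasisIndex) → N) (k : ℕ) :
    MultilinearMap O (fun _ : Fin k => ⨁ n, E n) N :=
  ((Basis.piTensorProduct fun _ : Fin k => R.totalBasis).constr O (c k)).compMultilinearMap
    (PiTensorProduct.tprod O)

lemma multilinearOfBasis_apply (c : ∀ k, (Fin k → R.BasisIndex) → N) {k : ℕ}
    (b : Fin k → R.BasisIndex) :
    R.multilinearOfBasis c k (fun i => R.totalBasis (b i)) = c k b := by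
  rw [multilinearOfBasis, LinearMap.compMultilinearMap_apply, ← Basis.piTensorProduct_apply,
    Module.Basis.constr_basis]

end FreeResolution

end Basis

/-! ### Graded symmetric lifts through the differential. -/

section Lift

variable {K : Type uK} {O : Type uO} {A : Type uA} {E : ℕ → Type uE} [Field K]
  [CommRing O] [Algebra K O]
  [∀ n, AddCommGroup (E n)] [∀ n, Module O (E n)] [AddCommGroup A] [Module O A]

namespace LetterMultilinear

variable {N : Type*} [AddCommGroup N] [Module O N] {φ ψ : List (Letter E) → N}

lemma sub (hφ : LetterMultilinear O φ) (hψ : LetterMultilinear O ψ) :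
    LetterMultilinear O fun w => φ w - ψ w where
  add u v a b c ha hb hc := by rw [hφ.add u v a b c ha hb hc, hψ.add u v a b c ha hb hc]; abel
  smul u v f a c ha hc := by rw [hφ.smul u v f a c ha hc, hψ.smul u v f a c ha hc, smul_sub]

lemma units_smul (hφ : LetterMultilinear O φ) (s : ℤˣ) :
    LetterMultilinear O fun w => s • φ w where
  add u v a b c ha hb hc := by rw [hφ.add u v a b c ha hb hc, smul_add]
  smul u v f a c ha hc := by rw [hφ.smul u v f a c ha hc, units_smul_smul_comm]

lemma append_left (hφ : LetterMultilinear O φ) (w : List (Letter E)) :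
    LetterMultilinear O fun v => φ (w ++ v) where
  add u v a b c ha hb hc := by
    simp only [← List.append_assoc]
    exact hφ.add (w ++ u) v a b c ha hb hc
  smul u v f a c ha hc := by
    simp only [← List.append_assoc]
    exact hφ.smul (w ++ u) v f a c ha hc

lemma append_right (hφ : LetterMultilinear O φ) (w : List (Letter E)) :
    LetterMultilinear O fun u => φ (u ++ w) where
  add u v a b c ha hb hc := by
    simp only [List.append_assoc, List.cons_append]
    exact hφ.add u (v ++ w) a b c ha hb hc
  smul u v f a c ha hc := by
    simp only [List.append_assoc, List.cons_append]
    exact hφ.smul u (v ++ w) f a c ha hc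

/-- Restriction of a multilinear function to the words of certain degrees. -/
lemma ite_degree (hφ : LetterMultilinear O φ) (p : ℤ → Prop) [DecidablePred p] :
    LetterMultilinear O fun w => if p (wordDegree Letter.deg w) then φ w else 0 where
  add u v a b c ha hb hc := by
    simp only [wordDegree_append, wordDegree_cons, ha, hb]
    split_ifs
    · exact hφ.add u v a b c ha hb hc
    · rw [add_zero]
  smul u v f a c ha hc := by
    simp only [wordDegree_append, wordDegree_cons, ha]
    split_ifs
    · exact hφ.smul u v f a c ha hc
    · rw [smul_zero]

lemma comp (hφ : LetterMultilinear O φ) {N' : Type*} [AddCommGroup N'] [Module O N']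
    (g : N →ₗ[O] N') : LetterMultilinear O fun w => g (φ w) where
  add u v a b c ha hb hc := by rw [hφ.add u v a b c ha hb hc, map_add]
  smul u v f a c ha hc := by rw [hφ.smul u v f a c ha hc, map_smul]

end LetterMultilinear

namespace FreeResolution

variable (R : FreeResolution O A E)

/-- Graded symmetry can be checked on the basis. -/
lemma gradedSymmetric_of_basis {φ : List (Letter E) → ⨁ n, E n} (hφ : LetterMultilinear O φ)
    (h : ∀ (u v : List R.BasisIndex) (a b : R.BasisIndex),
      φ ((u ++ a :: b :: v).map R.basisLetter) =
        ((R.basisLetter a).deg * (R.basisLetter b).deg).negOnePow •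
          φ ((u ++ b :: a :: v).map R.basisLetter)) :
    GradedSymmetric Letter.deg φ := by
  intro u v a b
  rw [← sub_eq_zero]
  refine R.word_ext (φ := fun v => φ (u ++ a :: b :: v) -
    (a.deg * b.deg).negOnePow • φ (u ++ b :: a :: v)) ?_ (fun v => ?_) v
  · have h1 := hφ.append_left (u ++ [a, b])
    have h2 := (hφ.append_left (u ++ [b, a])).units_smul (a.deg * b.deg).negOnePow
    simpa using h1.sub h2
  refine R.word_ext (φ := fun u => φ (u ++ a :: b :: v.map R.basisLetter) -
    (a.deg * b.deg).negOnePow • φ (u ++ b :: a :: v.map R.basisLetter)) ?_ (fun u => ?_) u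
  · exact (hφ.append_right _).sub ((hφ.append_right _).units_smul _)
  refine R.letter_ext (O := O) (F := fun b => φ (u.map R.basisLetter ++ a :: b ::
    v.map R.basisLetter) - (a.deg * b.deg).negOnePow • φ (u.map R.basisLetter ++ b :: a ::
    v.map R.basisLetter)) ?_ ?_ (fun b => ?_) b
  · intro x y z hx hy hz
    have h1 := (hφ.append_left (u.map R.basisLetter ++ [a])).add [] (v.map R.basisLetter) x y z
      hx hy hz
    have h2 := hφ.add (u.map R.basisLetter) (a :: v.map R.basisLetter) x y z hx hy hz
    simp only [List.append_assoc, List.cons_append, List.nil_append] at h1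
    simp only [h1, h2, hx, hy, smul_add]
    abel
  · intro f x z hx hz
    have h1 := (hφ.append_left (u.map R.basisLetter ++ [a])).smul [] (v.map R.basisLetter) f x z
      hx hz
    have h2 := hφ.smul (u.map R.basisLetter) (a :: v.map R.basisLetter) f x z hx hz
    simp only [List.append_assoc, List.cons_append, List.nil_append] at h1
    simp only [h1, h2, hx, smul_sub, units_smul_smul_comm]
  refine R.letter_ext (O := O) (F := fun a => φ (u.map R.basisLetter ++ a ::
    R.basisLetter b :: v.map R.basisLetter) - (a.deg * (R.basisLetter b).deg).negOnePow •
    φ (u.map R.basisLetter ++ R.basisLetter b :: a :: v.map R.basisLetter)) ?_ ?_ (fun a => ?_) a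
  · intro x y z hx hy hz
    have h1 := (hφ.append_left (u.map R.basisLetter ++ [R.basisLetter b])).add []
      (v.map R.basisLetter) x y z hx hy hz
    have h2 := hφ.add (u.map R.basisLetter) (R.basisLetter b :: v.map R.basisLetter) x y z hx hy hz
    simp only [List.append_assoc, List.cons_append, List.nil_append] at h1
    simp only [h1, h2, hx, hy, smul_add]
    abel
  · intro f x z hx hz
    have h1 := (hφ.append_left (u.map R.basisLetter ++ [R.basisLetter b])).smul []
      (v.map R.basisLetter) f x z hx hz
    have h2 := hφ.smul (u.map R.basisLetter) (R.basisLetter b :: v.map R.basisLetter) f x z hx hz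
    simp only [List.append_assoc, List.cons_append, List.nil_append] at h1
    simp only [h1, h2, hx, smul_sub, units_smul_smul_comm]
  simpa [sub_eq_zero] using h u v a b

end FreeResolution

lemma wordDegree_ofFn {α : Type*} (deg : α → ℤ) {n : ℕ} (x : Fin n → α) :
    wordDegree deg (List.ofFn x) = ∑ i, deg (x i) := by
  rw [wordDegree, List.map_ofFn, List.sum_ofFn]
  rfl

namespace FreeResolution

variable (R : FreeResolution O A E)

/-- The letters of a word in the basis. -/
lemma vals_basis {n : ℕ} (b : Fin n → R.BasisIndex) :
    vals ((List.ofFn b).map R.basisLetter) = List.ofFn fun i => R.totalBasis (b i) := by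
  rw [vals, List.map_map, List.map_ofFn]
  rfl

/-- The average of the values of `c` over all reorderings of a word, with Koszul signs. -/
noncomputable def koszulAverage (K : Type uK) [Field K] [Algebra K O]
    (c : ∀ k, (Fin k → R.BasisIndex) → ⨁ n, E n)
    (k : ℕ) (b : Fin k → R.BasisIndex) : ⨁ n, E n :=
  algebraMap K O (k.factorial : K)⁻¹ • ∑ σ : Equiv.Perm (Fin k),
    koszulSign (fun i => (R.basisLetter (b i)).deg) σ • c k fun i => b (σ i)

/-- Reindexing the sum by `σ ↦ τ * σ` and applying the cocycle rule. -/
lemma koszulAverage_perm (c : ∀ k, (Fin k → R.BasisIndex) → ⨁ n, E n) {k : ℕ}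
    (b : Fin k → R.BasisIndex) (τ : Equiv.Perm (Fin k)) :
    R.koszulAverage K c k b = koszulSign (fun i => (R.basisLetter (b i)).deg) τ •
      R.koszulAverage K c k fun i => b (τ i) := by
  rw [koszulAverage, koszulAverage, units_smul_smul_comm,
    ← Equiv.sum_comp (Equiv.mulLeft τ) fun σ => koszulSign
      (fun i => (R.basisLetter (b i)).deg) σ • c k fun i => b (σ i)]
  congr 1
  rw [Finset.smul_sum]
  refine Finset.sum_congr rfl fun σ _ => ?_
  rw [Equiv.coe_mulLeft, koszulSign_mul, mul_smul]
  rfl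

/-- A graded symmetric multilinear function with values in the boundaries lifts to a graded
symmetric multilinear function. -/
lemma exists_symmetric_lift (K : Type uK) [Field K] [CharZero K] [Algebra K O] {m D : ℤ}
    {ψ : List (Letter E) → ⨁ n, E n}
    (hψ : LetterMultilinear O ψ) (hs : GradedSymmetric Letter.deg ψ)
    (hshort : ∀ w, w.length < 2 → ψ w = 0)
    (hlift : ∀ l : List R.BasisIndex, wordDegree Letter.deg (l.map R.basisLetter) = D →
      ∃ y, IsHomogeneousOfDegree m y ∧ R.totalDiff y = ψ (l.map R.basisLetter)) :
    ∃ c : List (⨁ n, E n) → ⨁ n, E n, WordMultilinear O c ∧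
      GradedSymmetric Letter.deg (fun w => c (vals w)) ∧ (∀ l, l.length < 2 → c l = 0) ∧
      (∀ l, IsHomogeneousOfDegree m (c l)) ∧
      (∀ w, wordDegree Letter.deg w ≠ D → c (vals w) = 0) ∧
      ∀ w, wordDegree Letter.deg w = D → R.totalDiff (c (vals w)) = ψ w := by
  -- The lift is chosen to be zero outside degree `D` and on words of length below two, so that
  -- these vanishing properties survive averaging.
  have hex : ∀ (k : ℕ) (b : Fin k → R.BasisIndex), ∃ y, IsHomogeneousOfDegree m y ∧
      (wordDegree Letter.deg ((List.ofFn b).map R.basisLetter) = D ∧ 2 ≤ k →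
        R.totalDiff y = ψ ((List.ofFn b).map R.basisLetter)) ∧
      (¬ (wordDegree Letter.deg ((List.ofFn b).map R.basisLetter) = D ∧ 2 ≤ k) → y = 0) := by
    intro k b
    by_cases h : wordDegree Letter.deg ((List.ofFn b).map R.basisLetter) = D ∧ 2 ≤ k
    · obtain ⟨y, hy1, hy2⟩ := hlift _ h.1
      exact ⟨y, hy1, fun _ => hy2, fun h' => absurd h h'⟩
    · exact ⟨0, .zero m, fun h' => absurd h' h, fun _ => rfl⟩
  choose c₀ hc₀ hc₁ hc₂ using hex
  have hdeg : ∀ {k : ℕ} (b : Fin k → R.BasisIndex) (σ : Equiv.Perm (Fin k)),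
      wordDegree Letter.deg ((List.ofFn fun i => b (σ i)).map R.basisLetter) =
        wordDegree Letter.deg ((List.ofFn b).map R.basisLetter) := by
    intro k b σ
    rw [List.map_ofFn, List.map_ofFn, wordDegree_ofFn, wordDegree_ofFn]
    exact Equiv.sum_comp σ fun i => (R.basisLetter (b i)).deg
  have havg : ∀ {k : ℕ} (b : Fin k → R.BasisIndex),
      ¬ (wordDegree Letter.deg ((List.ofFn b).map R.basisLetter) = D ∧ 2 ≤ k) →
      R.koszulAverage K c₀ k b = 0 := by
    intro k b hb
    rw [koszulAverage, Finset.sum_eq_zero, smul_zero]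
    intro σ _
    rw [hc₂ _ _ (by rwa [hdeg]), smul_zero]
  set f := R.multilinearOfBasis (R.koszulAverage K c₀) with hf
  have hbasis : ∀ {k : ℕ} (b : Fin k → R.BasisIndex),
      wordFunction f (vals ((List.ofFn b).map R.basisLetter)) = R.koszulAverage K c₀ k b := by
    intro k b
    rw [vals_basis, wordFunction_ofFn, hf, multilinearOfBasis_apply]
  have hmul := wordFunction_multilinear f
  have hlet : LetterMultilinear O fun w : List (Letter E) => wordFunction f (vals w) :=
    hmul.letterMultilinear
  have hshort' : ∀ l, l.length < 2 → wordFunction f l = 0 := by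
    intro l hl
    have : f l.length = 0 := by
      refine Module.Basis.ext_multilinear (fun _ => R.totalBasis) fun b => ?_
      rw [hf, multilinearOfBasis_apply, havg b (by omega)]
      rfl
    rw [wordFunction, this]
    rfl
  refine ⟨wordFunction f, hmul, R.gradedSymmetric_of_basis hlet fun u v a b => ?_, hshort',
    fun l n hn => ?_, fun w hw => ?_, fun w hw => ?_⟩
  · obtain ⟨n, x, i, h1, h2, rfl, rfl⟩ := List.exists_ofFn_swap u v a b
    rw [h1, h2, hbasis, hbasis, R.koszulAverage_perm c₀ x (Equiv.swap i.castSucc i.succ),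
      koszulSign_swap]
  · have : (DirectSum.component O ℕ E n).compMultilinearMap (f l.length) = 0 := by
      refine Module.Basis.ext_multilinear (fun _ => R.totalBasis) fun b => ?_
      rw [LinearMap.compMultilinearMap_apply, hf, multilinearOfBasis_apply]
      have h : R.koszulAverage K c₀ l.length b ∈ homogeneousSubgroup E m := by
        refine homogeneous_smul _ ?_
        refine mem_homogeneousSubgroup.1 (sum_mem fun σ _ => ?_)
        rw [Units.smul_def]
        exact zsmul_mem (mem_homogeneousSubgroup.2 (hc₀ _ _)) _
      exact h n hn
    exact congrArg (fun g => g l.get) this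
  · have := R.word_ext (hlet.ite_degree fun d => d ≠ D) (fun l => by
      split_ifs with h
      · obtain ⟨k, b, rfl⟩ : ∃ (k : ℕ) (b : Fin k → R.BasisIndex), l = List.ofFn b :=
          ⟨_, _, (List.ofFn_get l).symm⟩
        rw [hbasis, havg b fun h' => h h'.1]
      · rfl) w
    rwa [if_pos hw] at this
  · have := R.word_ext (((hlet.comp R.totalDiff).sub hψ).ite_degree fun d => d = D) (fun l => by
      split_ifs with h
      · obtain ⟨k, b, rfl⟩ : ∃ (k : ℕ) (b : Fin k → R.BasisIndex), l = List.ofFn b :=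
          ⟨_, _, (List.ofFn_get l).symm⟩
        by_cases hk : 2 ≤ k
        · rw [hbasis, koszulAverage, map_smul, map_sum, sub_eq_zero]
          -- Since `ψ` is graded symmetric and signs square to one, every term of the average has
          -- the same boundary; the `k!` terms cancel the factor `1/k!`.
          have e : ∀ σ : Equiv.Perm (Fin k), R.totalDiff
              (koszulSign (fun i => (R.basisLetter (b i)).deg) σ • c₀ k fun i => b (σ i)) =
              ψ ((List.ofFn b).map R.basisLetter) := by
            intro σ
            rw [Units.smul_def, map_zsmul, hc₁ _ _ ⟨by rwa [hdeg], hk⟩, List.map_ofFn,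
              List.map_ofFn]
            have := hs.perm Letter.deg (fun i => R.basisLetter (b i)) σ
            simp only [Function.comp_def]
            rw [this, ← Units.smul_def, smul_smul, Int.units_mul_self, one_smul]
          rw [Finset.sum_congr rfl fun σ _ => e σ, Finset.sum_const, Finset.card_univ,
            Fintype.card_perm, Fintype.card_fin, ← Nat.cast_smul_eq_nsmul O, smul_smul,
            ← map_natCast (algebraMap K O), ← map_mul,
            inv_mul_cancel₀ (Nat.cast_ne_zero.2 k.factorial_ne_zero), map_one, one_smul]
        · have hl : ((List.ofFn b).map R.basisLetter).length < 2 := by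
            rw [List.length_map, List.length_ofFn]
            omega
          rw [hshort _ hl, hshort' _ (by rwa [length_vals]), map_zero, sub_zero]
      · rfl) w
    rwa [if_pos hw, sub_eq_zero] at this

end FreeResolution

end Lift

/-! ### The inductive step: killing the Jacobiator in one total degree. -/

section Correction

variable {K : Type uK} {O : Type uO} {A : Type uA} {E : ℕ → Type uE}
  [Field K] [CommRing O]
  [∀ n, AddCommGroup (E n)] [∀ n, Module O (E n)]
  [∀ n, Module K (E n)]

lemma algebraMap_smul_directSum [Algebra K O] [∀ n, IsScalarTower K O (E n)] (c : K)
    (x : ⨁ n, E n) : algebraMap K O c • x = c • x := by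
  ext n
  rw [DirectSum.smul_apply, DirectSum.smul_apply, algebraMap_smul]

lemma WordMultilinear.restrictScalars [Algebra K O] [∀ n, IsScalarTower K O (E n)]
    {q : List (⨁ n, E n) → ⨁ n, E n}
    (h : WordMultilinear O q) : WordMultilinear K q where
  add := h.add
  smul u v c a := by
    rw [← algebraMap_smul_directSum (O := O), h.smul, algebraMap_smul_directSum]

lemma wordDegree_nonpos {w : List (Letter E)} (hw : ∀ a ∈ w, a.deg < 0) :
    wordDegree Letter.deg w ≤ 0 := by
  induction w with
  | nil => simp
  | cons a w ih =>
    have h1 := hw a (by simp)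
    have h2 := ih fun b hb => hw b (by simp [hb])
    rw [wordDegree_cons]
    omega

lemma wordDegree_neg {w : List (Letter E)} (hw : ∀ a ∈ w, a.deg < 0) (hne : w ≠ []) :
    wordDegree Letter.deg w < 0 := by
  cases w with
  | nil => exact absurd rfl hne
  | cons a w =>
    have h1 := hw a (by simp)
    have h2 := wordDegree_nonpos fun b hb => hw b (List.mem_cons_of_mem a hb)
    rw [wordDegree_cons]
    omega

lemma wordDegree_lt_of_perm {u v w : List (Letter E)} (hw : ∀ a ∈ w, a.deg < 0)
    (h : (u ++ v).Perm w) (hv : v ≠ []) :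
    wordDegree Letter.deg w < wordDegree Letter.deg u := by
  rw [← h.wordDegree_eq, wordDegree_append]
  have := wordDegree_neg (fun a ha => hw a (h.subset (List.mem_append_right u ha))) hv
  omega

variable [LieRing A] [Module O A]

lemma FreeResolution.basisWord_deg_neg (R : FreeResolution O A E) (l : List R.BasisIndex) :
    ∀ a ∈ l.map R.basisLetter, a.deg < 0 := by
  intro a ha
  obtain ⟨b, _, rfl⟩ := List.mem_map.1 ha
  exact R.basisLetter_deg_neg b

variable [LieRingModule A O]

namespace AlmostAlgebroid

variable {R : FreeResolution O A E} {q : List (⨁ n, E n) → ⨁ n, E n}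

/-- In the Bianchi identity every term except `d (J w)` contains a Jacobiator of a word of higher
degree: a proper subword, since letters are negative, or a word in which a bracket has raised the
degree by one. -/
lemma totalDiff_jacobiator [CharZero K] (h : AlmostAlgebroid K R q) {w : List (Letter E)}
    (hw : ∀ a ∈ w, a.deg < 0)
    (hJ : ∀ u : List (Letter E), wordDegree Letter.deg w < wordDegree Letter.deg u →
      jacobiator q u = 0) :
    R.totalDiff (jacobiator q w) = 0 := by
  have hb := h.bianchi w
  rw [unshuffleSum_congr (w := w) Letter.deg
    (ψ := fun u v => if v = [] then q [jacobiator q u] else 0), unshuffleSum_right_nil,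
    h.unary, unshuffleSum_eq_zero] at hb
  · exact hb
  · intro u v huv
    refine hJ _ ?_
    rw [wordDegree_cons, GradedBrackets.output_deg, ← huv.wordDegree_eq, wordDegree_append]
    omega
  · intro u v huv
    split_ifs with hv
    · rw [hv]
      rfl
    · rw [hJ u (wordDegree_lt_of_perm hw huv hv), h.zero_head]

lemma jacobiator_singleton (h : AlmostAlgebroid K R q) (a : Letter E) :
    jacobiator q [a] = 0 := by
  simp only [jacobiator, unshuffleSum_cons, unshuffleSum_nil, vals_cons, vals_nil, h.nil,
    h.zero_head, smul_zero, add_zero, h.unary, R.totalDiff_totalDiff]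

lemma jacobiator_nil (h : AlmostAlgebroid K R q) : jacobiator (E := E) q [] = 0 := by
  simp only [jacobiator, unshuffleSum_nil, vals_nil, h.nil, h.zero_head]

lemma jacobiator_of_length_lt_two (h : AlmostAlgebroid K R q) (w : List (Letter E))
    (hw : w.length < 2) : jacobiator q w = 0 := by
  match w, hw with
  | [], _ => exact h.jacobiator_nil
  | [a], _ => exact h.jacobiator_singleton a

variable [Algebra K O] [∀ n, IsScalarTower K O (E n)]

/-- As `c` is `O`-multilinear, the Leibniz rule is unaffected; as `D ≥ 3`, its values have degree at
most `-2` and are invisible to the augmentation. -/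
lemma add_correction (h : AlmostAlgebroid K R q) {D : ℤ} (hD : 3 ≤ D)
    {c : List (⨁ n, E n) → ⨁ n, E n} (hc : WordMultilinear O c)
    (hsymm : GradedSymmetric Letter.deg fun w => c (vals w))
    (hshort : ∀ l, l.length < 2 → c l = 0)
    (hhom : ∀ l, IsHomogeneousOfDegree (-D + 1) (c l))
    (hdeg : ∀ w, wordDegree Letter.deg w ≠ -D → c (vals w) = 0) :
    AlmostAlgebroid K R fun l => q l + c l where
  multilinear :=
    { add u v a b := by rw [h.multilinear.add, hc.add]; abel
      smul u v f a := by rw [h.multilinear.smul, hc.restrictScalars.smul, smul_add] }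
  symm u v a b := by
    have h1 := h.symm u v a b
    have h2 := hsymm u v a b
    simp only at h1 h2 ⊢
    rw [h1, h2, smul_add]
  homog w := by
    refine mem_homogeneousSubgroup.1 (add_mem (h.homog w) ?_)
    by_cases hw : wordDegree Letter.deg w = -D
    · rw [hw]
      exact hhom _
    · rw [hdeg w hw]
      exact zero_mem _
  nil := by rw [h.nil, hshort _ (by simp), add_zero]
  unary x := by rw [h.unary, hshort _ (by simp), add_zero]
  smul_of_length u v f a huv := by rw [h.smul_of_length u v f a huv, hc.smul, smul_add]
  leibniz x y f := by
    rw [h.leibniz, show [x, f • y] = [x] ++ (f • y) :: [] from rfl, hc.smul, smul_add, add_assoc]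
    rfl
  aug_binary x y := by
    rw [map_add, h.aug_binary, R.totalAug_eq_zero (by omega) (hhom _), add_zero]
  aug_eq_zero l hl := by
    rw [map_add, h.aug_eq_zero l hl, R.totalAug_eq_zero (by omega) (hhom _), add_zero]

/-- Brackets that satisfy the Jacobi identities in degrees `> -D` can be corrected in degree `-D`
so as to satisfy the Jacobi identities in degree `-D`, too. -/
lemma exists_correction [CharZero K] (h : AlmostAlgebroid K R q) {D : ℤ} (hD : 3 ≤ D)
    [LieRinehartRing O A]
    (hJ : ∀ w : List (Letter E), -D < wordDegree Letter.deg w → jacobiator q w = 0) :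
    ∃ c : List (⨁ n, E n) → ⨁ n, E n, WordMultilinear O c ∧
      (∀ w, wordDegree Letter.deg w ≠ -D → c (vals w) = 0) ∧
      AlmostAlgebroid K R (fun l => q l + c l) ∧
      ∀ w : List (Letter E), -D ≤ wordDegree Letter.deg w →
        jacobiator (fun l => q l + c l) w = 0 := by
  obtain ⟨c, hc, hsymm, hshort, hhom, hdeg, hdc⟩ :=
    R.exists_symmetric_lift K (m := -D + 1) (D := -D) (ψ := fun w => (-1 : ℤˣ) • jacobiator q w)
      (h.jacobiator_multilinear.units_smul (-1))
      (fun u v a b => by simp only; rw [h.jacobiator_symm u v a b, smul_comm])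
      (fun w hw => by rw [h.jacobiator_of_length_lt_two w hw, smul_zero])
      (fun l hl => by
        have hh := h.jacobiator_homog (l.map R.basisLetter)
        rw [hl] at hh
        have hd := h.totalDiff_jacobiator (R.basisWord_deg_neg l) (fun u hu => hJ u (by omega))
        -- The Jacobiator has degree `-D + 2 < 0`; vanishing augmentation is needed for exactness
        -- when `D = 3`.
        obtain ⟨y, hy1, hy2⟩ := R.exists_totalDiff_eq (by omega) hh (h.aug_jacobiator _) hd
        refine ⟨-y, mem_homogeneousSubgroup.1 (neg_mem ?_), ?_⟩
        · rw [mem_homogeneousSubgroup]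
          convert hy1 using 1
          ring
        · rw [map_neg, hy2, Units.neg_smul, one_smul])
  have h' := h.add_correction hD hc hsymm hshort hhom hdeg
  refine ⟨c, hc, hdeg, h', fun w hw => ?_⟩
  have key := R.word_ext (h'.jacobiator_multilinear.ite_degree fun d => -D ≤ d) (fun l => by
    split_ifs with hl
    · have hneg := R.basisWord_deg_neg l
      -- For nonempty `v`, both `u` and the outer word have degree above `-D`, where `c` vanishes.
      -- The new contribution is therefore `d (c w)` alone.
      rw [jacobiator, unshuffleSum_congr (w := l.map R.basisLetter) Letter.deg
        (ψ := fun u v => q (q (vals u) :: vals v) +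
          if v = [] then R.totalDiff (c (vals u)) else 0), unshuffleSum_add,
        unshuffleSum_right_nil Letter.deg fun u => R.totalDiff (c (vals u))]
      · change jacobiator q _ + _ = 0
        rcases hl.eq_or_lt with hl | hl
        · rw [hdc _ hl.symm, Units.neg_smul, one_smul, add_neg_cancel]
        · rw [hJ _ hl, hdeg _ hl.ne', map_zero, add_zero]
      · intro u v huv
        split_ifs with hv
        · rw [hv, vals_nil, h.unary, h.unary, hshort [_] (by simp), add_zero, map_add]
        · have hu := wordDegree_lt_of_perm hneg huv hv
          have hc1 : c (vals u) = 0 := hdeg u (by omega)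
          have hc2 : c (q (vals u) :: vals v) = 0 := by
            have := hdeg (h.output u :: v) (by
              rw [wordDegree_cons, GradedBrackets.output_deg]
              have := huv.wordDegree_eq Letter.deg
              rw [wordDegree_append] at this
              omega)
            exact this
          rw [hc1, add_zero, hc2]
    · rfl) w
  rwa [if_pos hw] at key

end AlmostAlgebroid

end Correction

/-! ### A flat connection and the lift of its bracket defect. -/

section Connection

variable {O : Type uO} {A : Type uA} {E : ℕ → Type uE} [CommRing O]
  [∀ n, AddCommGroup (E n)] [∀ n, Module O (E n)] [LieRing A] [Module O A]

namespace FreeResolution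

variable (R : FreeResolution O A E)

lemma totalBasis_repr_ext {v w : ⨁ n, E n}
    (h : ∀ b, R.totalBasis.repr v b = R.totalBasis.repr w b) : v = w :=
  R.totalBasis.repr.injective (Finsupp.ext h)

lemma totalDiff_homog {m : ℤ} {v : ⨁ n, E n} (hv : IsHomogeneousOfDegree m v) :
    IsHomogeneousOfDegree (m + 1) (R.totalDiff v) := fun n hn => by
  rw [totalDiff_apply, hv (n + 1) (by push_cast; omega), map_zero]

variable [LieRingModule A O]

/-- The flat connection for which the basis vectors are constant. -/
noncomputable def nabla (a : A) (v : ⨁ n, E n) : ⨁ n, E n :=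
  R.totalBasis.repr.symm (Finsupp.mapRange (fun f : O => ⁅a, f⁆) (lie_zero a)
    (R.totalBasis.repr v))

lemma nabla_repr (a : A) (v : ⨁ n, E n) (b : R.BasisIndex) :
    R.totalBasis.repr (R.nabla a v) b = ⁅a, R.totalBasis.repr v b⁆ := by
  rw [nabla, LinearEquiv.apply_symm_apply, Finsupp.mapRange_apply]

lemma nabla_add (a : A) (v w : ⨁ n, E n) : R.nabla a (v + w) = R.nabla a v + R.nabla a w :=
  R.totalBasis_repr_ext fun b => by
    simp only [nabla_repr, map_add, Finsupp.add_apply, lie_add]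

lemma add_nabla (a b : A) (v : ⨁ n, E n) : R.nabla (a + b) v = R.nabla a v + R.nabla b v :=
  R.totalBasis_repr_ext fun b => by
    simp only [nabla_repr, map_add, Finsupp.add_apply, add_lie]

lemma zero_nabla (v : ⨁ n, E n) : R.nabla 0 v = 0 :=
  R.totalBasis_repr_ext fun b => by
    simp only [nabla_repr, map_zero, Finsupp.zero_apply, zero_lie]

/-- The connection as a homomorphism. -/
noncomputable def nablaHom (a : A) : (⨁ n, E n) →+ ⨁ n, E n :=
  AddMonoidHom.mk' (R.nabla a) (R.nabla_add a)

lemma nabla_units_smul (a : A) (s : ℤˣ) (v : ⨁ n, E n) :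
    R.nabla a (s • v) = s • R.nabla a v := by
  rw [Units.smul_def, Units.smul_def]
  exact map_zsmul (R.nablaHom a) _ _

lemma nabla_neg (a : A) (v : ⨁ n, E n) : R.nabla a (-v) = -R.nabla a v :=
  map_neg (R.nablaHom a) v

lemma nabla_apply_eq_zero (a : A) {v : ⨁ n, E n} {n : ℕ} (hv : v n = 0) :
    R.nabla a v n = 0 := by
  apply (R.termBasis n).repr.injective
  ext i
  have := R.nabla_repr a v ⟨n, i⟩
  rw [totalBasis_repr, totalBasis_repr] at this
  simp only [this, hv, map_zero, Finsupp.zero_apply, lie_zero]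

lemma nabla_apply_congr (a : A) {v w : ⨁ n, E n} {n : ℕ} (h : v n = w n) :
    R.nabla a v n = R.nabla a w n := by
  have h0 : (v - w) n = 0 := by rw [DirectSum.sub_apply, h, sub_self]
  have := R.nabla_apply_eq_zero a h0
  rwa [sub_eq_add_neg, nabla_add, nabla_neg, ← sub_eq_add_neg, DirectSum.sub_apply,
    sub_eq_zero] at this

lemma nabla_homog (a : A) {m : ℤ} {v : ⨁ n, E n} (hv : IsHomogeneousOfDegree m v) :
    IsHomogeneousOfDegree m (R.nabla a v) := fun n hn => R.nabla_apply_eq_zero a (hv n hn)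

lemma totalAug_nabla_congr (a : A) {v w : ⨁ n, E n} (h : v 0 = w 0) :
    R.totalAug (R.nabla a v) = R.totalAug (R.nabla a w) := by
  rw [totalAug_apply, totalAug_apply, R.nabla_apply_congr a h]

/-- The operator that multiplies the elements of degree `m` by `(-1)^m`. -/
noncomputable def parity (O : Type uO) [CommRing O] (E : ℕ → Type uE) [∀ n, AddCommGroup (E n)]
    [∀ n, Module O (E n)] : (⨁ n, E n) →ₗ[O] ⨁ n, E n :=
  DirectSum.toModule O ℕ _ fun n =>
    ((-((n : ℤ) + 1)).negOnePow : ℤ) • DirectSum.lof O ℕ E n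

lemma parity_of (n : ℕ) (y : E n) : parity O E (DirectSum.of E n y) =
    (-((n : ℤ) + 1)).negOnePow • DirectSum.of E n y := by
  rw [parity, ← DirectSum.lof_eq_of O, DirectSum.toModule_lof, LinearMap.smul_apply,
    Units.smul_def]

lemma parity_letter (a : Letter E) : parity O E a.val = a.deg.negOnePow • a.val := by
  obtain ⟨m, x, hx⟩ := a
  by_cases hm : 0 ≤ m
  · simp [LieInftyAlgebroid.eq_zero_of_isHomogeneous hm hx]
  · obtain ⟨n, rfl⟩ : ∃ n : ℕ, m = -((n : ℤ) + 1) := ⟨(-m - 1).toNat, by omega⟩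
    simp only
    rw [LieInftyAlgebroid.eq_of_isHomogeneous rfl hx, parity_of]

lemma parity_apply_zero (v : ⨁ n, E n) : parity O E v 0 = -v 0 := by
  induction v using DirectSum.induction_on with
  | zero => simp
  | add x y hx hy => rw [map_add, DirectSum.add_apply, hx, hy, DirectSum.add_apply, neg_add]
  | of i x =>
    rw [parity_of]
    by_cases hi : i = 0
    · subst hi
      have : (-(((0 : ℕ) : ℤ) + 1)).negOnePow = -1 := by simp
      rw [this, Units.neg_smul, one_smul, ← map_neg, DirectSum.of_eq_same, DirectSum.of_eq_same]
    · rw [Units.smul_def, ← map_zsmul, DirectSum.of_eq_of_ne _ _ _ (Ne.symm hi),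
        DirectSum.of_eq_of_ne _ _ _ (Ne.symm hi), neg_zero]

variable [LieRinehartRing O A]

lemma smul_nabla (f : O) (a : A) (v : ⨁ n, E n) : R.nabla (f • a) v = f • R.nabla a v :=
  R.totalBasis_repr_ext fun b => by
    simp only [nabla_repr, map_smul, Finsupp.smul_apply, LieRinehartRing.lie_smul_eq_mul,
      smul_eq_mul]

lemma nabla_smul (f : O) (a : A) (v : ⨁ n, E n) :
    R.nabla a (f • v) = ⁅a, f⁆ • v + f • R.nabla a v :=
  R.totalBasis_repr_ext fun b => by
    simp only [nabla_repr, map_smul, map_add, Finsupp.smul_apply, Finsupp.add_apply,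
      LieRinehartRing.leibniz_mul_right, smul_eq_mul]
    ring

/-- The failure of the binary bracket defined by the connection to lift the bracket of `A`. -/
noncomputable def bracketDefect : E 0 →ₗ[O] E 0 →ₗ[O] A :=
  LinearMap.mk₂ O (fun x y => ⁅R.aug x, R.aug y⁆ -
      R.totalAug (R.nabla (R.aug x) (DirectSum.lof O ℕ E 0 y)) +
      R.totalAug (R.nabla (R.aug y) (DirectSum.lof O ℕ E 0 x)))
    (fun x x' y => by simp only [map_add, add_lie, add_nabla, nabla_add]; abel)
    (fun f x y => by
      have h : R.totalAug (DirectSum.lof O ℕ E 0 x) = R.aug x := by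
        rw [totalAug_apply, DirectSum.lof_eq_of, DirectSum.of_eq_same]
      simp only [map_smul, map_add, smul_nabla, nabla_smul, h, smul_add, smul_sub]
      -- The derivative of `f` from the bracket of `A` cancels the one from the connection.
      rw [← lie_skew, LieRinehartRing.leibniz_smul_right, ← lie_skew (R.aug x)]
      simp only [smul_neg]
      abel)
    (fun x y y' => by simp only [map_add, lie_add, add_nabla, nabla_add]; abel)
    (fun f x y => by
      have h : R.totalAug (DirectSum.lof O ℕ E 0 y) = R.aug y := by
        rw [totalAug_apply, DirectSum.lof_eq_of, DirectSum.of_eq_same]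
      simp only [map_smul, map_add, smul_nabla, nabla_smul, h, smul_add, smul_sub,
        LieRinehartRing.leibniz_smul_right]
      abel)

lemma bracketDefect_apply (x y : E 0) : R.bracketDefect x y = ⁅R.aug x, R.aug y⁆ -
      R.totalAug (R.nabla (R.aug x) (DirectSum.of E 0 y)) +
      R.totalAug (R.nabla (R.aug y) (DirectSum.of E 0 x)) := rfl

lemma bracketDefect_swap (x y : E 0) : R.bracketDefect y x = -R.bracketDefect x y := by
  rw [bracketDefect_apply, bracketDefect_apply, ← lie_skew]
  abel

/-- The tensor square of the free module `E 0` is projective, so the bilinear defect lifts through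
the surjection `R.aug`; halving the antisymmetrisation keeps it a lift, as the defect is
antisymmetric. -/
lemma exists_bracket_lift (K : Type uK) [Field K] [CharZero K] [Algebra K O] :
    ∃ β : E 0 →ₗ[O] E 0 →ₗ[O] E 0, (∀ x y, β y x = -β x y) ∧
      ∀ x y, R.aug (β x y) = R.bracketDefect x y := by
  have := R.free 0
  obtain ⟨g, hg⟩ := Module.projective_lifting_property R.aug
    (TensorProduct.lift R.bracketDefect) R.aug_surjective
  let β₀ := TensorProduct.curry g
  have hβ₀ : ∀ x y, R.aug (β₀ x y) = R.bracketDefect x y := fun x y => by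
    rw [← TensorProduct.lift.tmul (f' := R.bracketDefect), ← hg]
    rfl
  refine ⟨algebraMap K O 2⁻¹ • (β₀ - β₀.flip), fun x y => ?_, fun x y => ?_⟩
  · simp only [LinearMap.smul_apply, LinearMap.sub_apply, LinearMap.flip_apply, ← smul_neg,
      neg_sub]
  · simp only [LinearMap.smul_apply, LinearMap.sub_apply, LinearMap.flip_apply, map_smul, map_sub,
      hβ₀]
    rw [R.bracketDefect_swap x y, sub_neg_eq_add, ← two_smul O, smul_smul,
      ← map_ofNat (algebraMap K O), ← map_mul, inv_mul_cancel₀ two_ne_zero, map_one, one_smul]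

end FreeResolution

end Connection

/-! ### The initial almost algebroid. -/

section Base

variable {K : Type uK} {O : Type uO} {A : Type uA} {E : ℕ → Type uE}
  [Field K] [CommRing O] [Algebra K O]
  [∀ n, AddCommGroup (E n)] [∀ n, Module O (E n)]
  [LieRing A] [Module O A] [LieRingModule A O]

namespace FreeResolution

variable (R : FreeResolution O A E) (β : E 0 →ₗ[O] E 0 →ₗ[O] E 0)

/-- The binary bracket defined by the flat connection and a correction term `β`. -/
noncomputable def baseBinary (x y : ⨁ n, E n) : ⨁ n, E n :=
  R.nabla (R.totalAug x) y + R.nabla (R.totalAug y) (parity O E x) +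
    DirectSum.lof O ℕ E 0 (β (x 0) (y 0))

/-- The brackets given by the differential and the binary bracket `baseBinary`. -/
noncomputable def baseBrackets (l : List (⨁ n, E n)) : ⨁ n, E n :=
  match l with
  | [x] => R.totalDiff x
  | [x, y] => R.baseBinary β x y
  | _ => 0

variable {R β}

lemma baseBrackets_of_length {l : List (⨁ n, E n)} (h1 : l.length ≠ 1) (h2 : l.length ≠ 2) :
    R.baseBrackets β l = 0 := by
  match l, h1, h2 with
  | [], _, _ => rfl
  | [x], h1, _ => simp at h1
  | [x, y], _, h2 => simp at h2
  | _ :: _ :: _ :: _, _, _ => rfl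

lemma baseBinary_add_left (x x' y : ⨁ n, E n) :
    R.baseBinary β (x + x') y = R.baseBinary β x y + R.baseBinary β x' y := by
  simp only [baseBinary, map_add, add_nabla, nabla_add, DirectSum.add_apply, LinearMap.add_apply]
  abel

lemma baseBinary_add_right (x y y' : ⨁ n, E n) :
    R.baseBinary β x (y + y') = R.baseBinary β x y + R.baseBinary β x y' := by
  simp only [baseBinary, map_add, add_nabla, nabla_add, DirectSum.add_apply]
  abel

lemma baseBinary_symm (hβ : ∀ x y, β y x = -β x y) (a b : Letter E) :
    R.baseBinary β a.val b.val = (a.deg * b.deg).negOnePow • R.baseBinary β b.val a.val := by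
  have h1 : R.nabla (R.totalAug a.val) b.val = (a.deg * b.deg).negOnePow •
      R.nabla (R.totalAug a.val) (parity O E b.val) := by
    rw [parity_letter, nabla_units_smul, smul_smul, ← Int.negOnePow_add]
    by_cases ha : a.deg = -1
    · rw [ha, Int.negOnePow_even _ ⟨0, by ring⟩, one_smul]
    · rw [R.totalAug_eq_zero ha a.homog, zero_nabla, smul_zero]
  have h2 : R.nabla (R.totalAug b.val) (parity O E a.val) = (a.deg * b.deg).negOnePow •
      R.nabla (R.totalAug b.val) a.val := by
    rw [parity_letter, nabla_units_smul]
    by_cases hb : b.deg = -1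
    · rw [hb, mul_neg_one, Int.negOnePow_neg]
    · rw [R.totalAug_eq_zero hb b.homog, zero_nabla, smul_zero, smul_zero]
  have h3 : DirectSum.lof O ℕ E 0 (β (a.val 0) (b.val 0)) = (a.deg * b.deg).negOnePow •
      DirectSum.lof O ℕ E 0 (β (b.val 0) (a.val 0)) := by
    by_cases ha : a.deg = -1
    · by_cases hb : b.deg = -1
      · have s1 : ((-1 : ℤ) * -1).negOnePow = -1 := rfl
        rw [ha, hb, s1, hβ, map_neg, Units.neg_smul, one_smul]
      · rw [b.homog 0 (by simpa using Ne.symm hb)]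
        simp
    · rw [a.homog 0 (by simpa using Ne.symm ha)]
      simp
  rw [baseBinary, baseBinary, smul_add, smul_add, ← h1, ← h2, ← h3,
    add_comm (R.nabla (R.totalAug b.val) (parity O E a.val))]

lemma baseBinary_homog (a b : Letter E) :
    IsHomogeneousOfDegree (a.deg + b.deg + 1) (R.baseBinary β a.val b.val) := by
  refine mem_homogeneousSubgroup.1 (add_mem (add_mem ?_ ?_) ?_)
  · by_cases ha : a.deg = -1
    · rw [ha, neg_add_cancel_comm]
      exact R.nabla_homog _ b.homog
    · rw [R.totalAug_eq_zero ha a.homog, zero_nabla]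
      exact zero_mem _
  · by_cases hb : b.deg = -1
    · rw [hb, neg_add_cancel_right, parity_letter, nabla_units_smul, Units.smul_def]
      exact zsmul_mem (mem_homogeneousSubgroup.2 (R.nabla_homog _ a.homog)) _
    · rw [R.totalAug_eq_zero hb b.homog, zero_nabla]
      exact zero_mem _
  · by_cases ha : a.deg = -1
    · by_cases hb : b.deg = -1
      · rw [ha, hb, DirectSum.lof_eq_of]
        exact LieInftyAlgebroid.isHomogeneous_of 0 _
      · rw [b.homog 0 (by simpa using Ne.symm hb), map_zero, map_zero]
        exact zero_mem _
    · rw [a.homog 0 (by simpa using Ne.symm ha), map_zero, LinearMap.zero_apply, map_zero]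
      exact zero_mem _

variable [LieRinehartRing O A]

lemma baseBinary_leibniz (x y : ⨁ n, E n) (f : O) :
    R.baseBinary β x (f • y) = ⁅R.totalAug x, f⁆ • y + f • R.baseBinary β x y := by
  simp only [baseBinary, map_smul, nabla_smul, smul_nabla, DirectSum.smul_apply, smul_add]
  abel

/-- Only components in degree `-1` matter. There the parity operator is `-1`, and `β` restores
exactly what the connection terms miss. -/
lemma totalAug_baseBinary (hβ : ∀ x y, R.aug (β x y) = R.bracketDefect x y)
    (x y : ⨁ n, E n) :
    R.totalAug (R.baseBinary β x y) = ⁅R.totalAug x, R.totalAug y⁆ := by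
  have h1 : R.totalAug (DirectSum.lof O ℕ E 0 (β (x 0) (y 0))) = R.aug (β (x 0) (y 0)) := by
    rw [totalAug_apply, DirectSum.lof_eq_of, DirectSum.of_eq_same]
  have h2 := R.totalAug_nabla_congr (R.totalAug x) (v := y) (w := DirectSum.of E 0 (y 0))
    (by rw [DirectSum.of_eq_same])
  have h3 := R.totalAug_nabla_congr (R.totalAug y) (v := parity O E x)
    (w := -DirectSum.of E 0 (x 0)) (by
      rw [parity_apply_zero, ← map_neg, DirectSum.of_eq_same])
  rw [baseBinary, map_add, map_add, h1, hβ, bracketDefect_apply, h2, h3, nabla_neg, map_neg,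
    ← totalAug_apply, ← totalAug_apply]
  abel

variable [∀ n, Module K (E n)] [∀ n, IsScalarTower K O (E n)]
  [LieAlgebra K A] [LieRinehartAlgebra K O A]

lemma lie_algebraMap (a : A) (c : K) : ⁅a, algebraMap K O c⁆ = 0 :=
  (LieRinehartAlgebra.anchor K O A a).map_algebraMap c

lemma baseBinary_smul_right (c : K) (x y : ⨁ n, E n) :
    R.baseBinary β x (c • y) = c • R.baseBinary β x y := by
  rw [← algebraMap_smul_directSum (O := O), baseBinary_leibniz, lie_algebraMap, zero_smul,
    zero_add, algebraMap_smul_directSum]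

lemma baseBinary_smul_left (c : K) (x y : ⨁ n, E n) :
    R.baseBinary β (c • x) y = c • R.baseBinary β x y := by
  rw [← algebraMap_smul_directSum (O := O), ← algebraMap_smul_directSum (O := O)]
  simp only [baseBinary, map_smul, nabla_smul, smul_nabla, DirectSum.smul_apply, smul_add,
    lie_algebraMap, zero_smul, zero_add, LinearMap.smul_apply]

/-- No compatibility of the differential with the binary bracket is required at this stage; it is
the Jacobi identity for two letters, obtained later by correction. -/
lemma almostAlgebroid_baseBrackets (hβ : ∀ x y, β y x = -β x y)
    (hβ' : ∀ x y, R.aug (β x y) = R.bracketDefect x y) :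
    AlmostAlgebroid K R (R.baseBrackets β) where
  multilinear :=
    { add u v a b := by
        match u, v with
        | [], [] => exact map_add _ _ _
        | [], [y] => exact baseBinary_add_left a b y
        | [x], [] => exact baseBinary_add_right x a b
        | [], _ :: _ :: _ => simp [baseBrackets]
        | [_], _ :: _ => simp [baseBrackets]
        | _ :: _ :: _, _ =>
          rw [baseBrackets_of_length, baseBrackets_of_length, baseBrackets_of_length, add_zero]
          all_goals simp
      smul u v c a := by
        match u, v with
        | [], [] =>
          change R.totalDiff (c • a) = c • R.totalDiff a
          rw [← algebraMap_smul_directSum (O := O), map_smul, algebraMap_smul_directSum]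
        | [], [y] => exact baseBinary_smul_left c a y
        | [x], [] => exact baseBinary_smul_right c x a
        | [], _ :: _ :: _ => simp [baseBrackets]
        | [_], _ :: _ => simp [baseBrackets]
        | _ :: _ :: _, _ =>
          rw [baseBrackets_of_length, baseBrackets_of_length, smul_zero]
          all_goals simp }
  symm u v a b := by
    match u, v with
    | [], [] => exact baseBinary_symm hβ a b
    | [], _ :: _ => simp [baseBrackets]
    | _ :: _, _ =>
      simp only
      rw [baseBrackets_of_length, baseBrackets_of_length, smul_zero]
      all_goals simp <;> omega
  homog w := by
    match w with
    | [] => exact .zero _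
    | [a] =>
      rw [wordDegree_cons, wordDegree_nil, add_zero]
      exact R.totalDiff_homog a.homog
    | [a, b] =>
      rw [wordDegree_cons, wordDegree_cons, wordDegree_nil, add_zero]
      exact baseBinary_homog a b
    | _ :: _ :: _ :: _ => exact .zero _
  nil := rfl
  unary _ := rfl
  smul_of_length u v f a huv := by
    match u, v, huv with
    | [], [], _ => exact map_smul _ _ _
    | [], [y], huv => simp at huv
    | [x], [], huv => simp at huv
    | [], _ :: _ :: _, _ => simp [baseBrackets]
    | [_], _ :: _, _ => simp [baseBrackets]
    | _ :: _ :: _, _, _ =>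
      rw [baseBrackets_of_length, baseBrackets_of_length, smul_zero]
      all_goals simp
  leibniz := baseBinary_leibniz
  aug_binary := totalAug_baseBinary hβ'
  aug_eq_zero l hl := by
    by_cases h1 : l.length = 1
    · obtain ⟨x, rfl⟩ := List.length_eq_one_iff.1 h1
      exact R.totalAug_totalDiff x
    · rw [baseBrackets_of_length h1 hl, map_zero]

end FreeResolution

end Base

/-! ### Iterating the corrections and passing to the limit. -/

section Limit

open Filter

variable {K : Type uK} {O : Type uO} {A : Type uA} {E : ℕ → Type uE}
  [Field K] [CommRing O]
  [∀ n, AddCommGroup (E n)] [∀ n, Module O (E n)]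

lemma eventually_unshuffleSum {α M : Type*} [AddCommGroup M] (deg : α → ℤ)
    {φ : ℕ → List α → List α → M} {ψ : List α → List α → M}
    (h : ∀ u v, ∀ᶠ n in atTop, φ n u v = ψ u v) (w : List α) :
    ∀ᶠ n in atTop, unshuffleSum deg (φ n) w = unshuffleSum deg ψ w := by
  induction w generalizing φ ψ with
  | nil => exact h [] []
  | cons a w ih =>
    have h1 := ih (φ := fun n u v => φ n (a :: u) v) (ψ := fun u v => ψ (a :: u) v)
      fun u v => h _ _
    have h2 := ih (φ := fun n u v => (deg a * wordDegree deg u).negOnePow • φ n u (a :: v))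
      (ψ := fun u v => (deg a * wordDegree deg u).negOnePow • ψ u (a :: v))
      fun u v => (h u (a :: v)).mono fun n hn => by rw [hn]
    filter_upwards [h1, h2] with n hn1 hn2
    rw [unshuffleSum_cons, unshuffleSum_cons, hn1, hn2]

lemma eventually_jacobiator {q : ℕ → List (⨁ n, E n) → ⨁ n, E n}
    {r : List (⨁ n, E n) → ⨁ n, E n} (h : ∀ l, ∀ᶠ n in atTop, q n l = r l)
    (w : List (Letter E)) : ∀ᶠ n in atTop, jacobiator (q n) w = jacobiator r w := by
  refine eventually_unshuffleSum Letter.deg (fun u v => ?_) w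
  filter_upwards [h (vals u), h (r (vals u) :: vals v)] with n h1 h2
  rw [h1, h2]

/-- A multilinear function supported in degree `-(n + 3)` vanishes on a given word for large `n`. -/
lemma eventually_eq_zero {c : ℕ → List (⨁ n, E n) → ⨁ n, E n}
    (hc : ∀ n, WordMultilinear O (c n))
    (hdeg : ∀ (n : ℕ) w, wordDegree Letter.deg w ≠ -((n : ℤ) + 3) → c n (vals w) = 0)
    (l : List (⨁ n, E n)) : ∀ᶠ n in atTop, c n l = 0 := by
  -- Entries are split into homogeneous parts one by one, and `u` collects those already treated. A
  -- word of letters has a single degree, which `-(n + 3)` eventually leaves behind.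
  have key : ∀ (l : List (⨁ n, E n)) (u : List (Letter E)),
      ∀ᶠ n : ℕ in atTop, c n (vals u ++ l) = 0 := by
    intro l
    induction l with
    | nil =>
      intro u
      filter_upwards [eventually_gt_atTop (wordDegree Letter.deg u).natAbs] with n hn
      rw [List.append_nil]
      exact hdeg n u (by omega)
    | cons a l ih =>
      intro u
      induction a using DirectSum.induction_on with
      | zero => exact Eventually.of_forall fun n => (hc n).zero _ _
      | of i x =>
        have := ih (u ++ [homogeneousLetter i x])
        simp only [vals_append, vals_cons, vals_nil, List.append_assoc, List.cons_append,
          List.nil_append] at this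
        exact this
      | add x y hx hy =>
        filter_upwards [hx, hy] with n h1 h2
        rw [(hc n).add, h1, h2, add_zero]
  exact key l []

variable [∀ n, Module K (E n)]
  [LieRing A] [Module O A] [LieRingModule A O]

/-- Every axiom involves finitely many words, so it can be read off at one stage at which all of
them have stabilised. -/
lemma AlmostAlgebroid.of_eventually {R : FreeResolution O A E}
    {q : ℕ → List (⨁ n, E n) → ⨁ n, E n} {r : List (⨁ n, E n) → ⨁ n, E n}
    (hq : ∀ n, AlmostAlgebroid K R (q n)) (h : ∀ l, ∀ᶠ n in atTop, q n l = r l) :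
    AlmostAlgebroid K R r where
  multilinear :=
    { add u v a b := by
        obtain ⟨n, h1, h2, h3⟩ := ((h (u ++ (a + b) :: v)).and
          ((h (u ++ a :: v)).and (h (u ++ b :: v)))).exists
        rw [← h1, ← h2, ← h3, (hq n).multilinear.add]
      smul u v c a := by
        obtain ⟨n, h1, h2⟩ := ((h (u ++ (c • a) :: v)).and (h (u ++ a :: v))).exists
        rw [← h1, ← h2, (hq n).multilinear.smul] }
  symm u v a b := by
    obtain ⟨n, h1, h2⟩ := ((h (vals (u ++ a :: b :: v))).and
      (h (vals (u ++ b :: a :: v)))).exists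
    simp only [← h1, ← h2]
    exact (hq n).symm u v a b
  homog w := by
    obtain ⟨n, h1⟩ := (h (vals w)).exists
    rw [← h1]
    exact (hq n).homog w
  nil := by
    obtain ⟨n, h1⟩ := (h []).exists
    rw [← h1, (hq n).nil]
  unary x := by
    obtain ⟨n, h1⟩ := (h [x]).exists
    rw [← h1, (hq n).unary]
  smul_of_length u v f a huv := by
    obtain ⟨n, h1, h2⟩ := ((h (u ++ (f • a) :: v)).and (h (u ++ a :: v))).exists
    rw [← h1, ← h2, (hq n).smul_of_length u v f a huv]
  leibniz x y f := by
    obtain ⟨n, h1, h2⟩ := ((h [x, f • y]).and (h [x, y])).exists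
    rw [← h1, ← h2, (hq n).leibniz]
  aug_binary x y := by
    obtain ⟨n, h1⟩ := (h [x, y]).exists
    rw [← h1, (hq n).aug_binary]
  aug_eq_zero l hl := by
    obtain ⟨n, h1⟩ := (h l).exists
    rw [← h1, (hq n).aug_eq_zero l hl]

variable [LieRinehartRing O A]

/-- There are brackets that satisfy all higher Jacobi identities. -/
lemma exists_homotopy_brackets (K : Type uK) [Field K] [CharZero K] [Algebra K O]
    [∀ n, Module K (E n)] [∀ n, IsScalarTower K O (E n)] [LieAlgebra K A]
    [LieRinehartAlgebra K O A] (R : FreeResolution O A E) :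
    ∃ q : List (⨁ n, E n) → ⨁ n, E n, AlmostAlgebroid K R q ∧ ∀ w, jacobiator q w = 0 := by
  obtain ⟨β, hβ, hβ'⟩ := R.exists_bracket_lift K
  let S : ℕ → Type _ := fun n => {q : List (⨁ n, E n) → ⨁ n, E n // AlmostAlgebroid K R q ∧
    ∀ w : List (Letter E), -((n : ℤ) + 3) < wordDegree Letter.deg w → jacobiator q w = 0}
  have hbase := FreeResolution.almostAlgebroid_baseBrackets (K := K) hβ hβ'
  have step : ∀ (n : ℕ) (s : S n), ∃ (t : S (n + 1)) (c : List (⨁ n, E n) → ⨁ n, E n),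
      WordMultilinear O c ∧
      (∀ w, wordDegree Letter.deg w ≠ -((n : ℤ) + 3) → c (vals w) = 0) ∧
      ∀ l, t.1 l = s.1 l + c l := by
    intro n s
    obtain ⟨c, h1, h2, h3, h4⟩ := s.2.1.exists_correction (D := (n : ℤ) + 3) (by omega) s.2.2
    exact ⟨⟨_, h3, fun w hw => h4 w (by push_cast at hw; omega)⟩, c, h1, h2, fun l => rfl⟩
  choose next c hc hdeg hnext using step
  -- At stage `0` the Jacobiator of a word of degree `> -3` has degree `≥ 0`, hence is zero.
  let s : ∀ n, S n := fun n => Nat.rec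
    ⟨R.baseBrackets β, hbase, fun w hw =>
      LieInftyAlgebroid.eq_zero_of_isHomogeneous (by push_cast at hw; omega)
        (hbase.jacobiator_homog w)⟩ (fun n s => next n s) n
  have hzero := eventually_eq_zero (fun n => hc n (s n)) fun n => hdeg n (s n)
  have hstable : ∀ l, ∃ N, ∀ n, N ≤ n → (s n).1 l = (s N).1 l := by
    intro l
    obtain ⟨N, hN⟩ := eventually_atTop.1 (hzero l)
    refine ⟨N, fun n hn => ?_⟩
    induction n, hn using Nat.le_induction with
    | base => rfl
    | succ n hn ih =>
      exact (hnext n (s n) l).trans (by rw [hN n hn, add_zero, ih])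
  choose N hN using hstable
  have hev : ∀ l, ∀ᶠ n in atTop, (s n).1 l = (s (N l)).1 l := fun l =>
    eventually_atTop.2 ⟨N l, hN l⟩
  refine ⟨_, .of_eventually (fun n => (s n).2.1) hev, fun w => ?_⟩
  -- A stage late enough both to agree with the limit on this Jacobiator and to have reached the
  -- degree of `w`.
  obtain ⟨n, h1, h2⟩ := ((eventually_jacobiator hev w).and
    (eventually_gt_atTop (wordDegree Letter.deg w).natAbs)).exists
  rw [← h1]
  exact (s n).2.2 w (by omega)

end Limit

/-! ### From brackets on words to a Lie `∞`-algebroid. -/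

lemma List.ofFn_update {α : Type*} {n : ℕ} [DecidableEq (Fin (n + 1))] (x : Fin (n + 1) → α)
    (i : Fin (n + 1)) (a : α) :
    List.ofFn (Function.update x i a) = (List.ofFn fun j => x (i.succAbove j)).take i ++
      a :: (List.ofFn fun j => x (i.succAbove j)).drop i := by
  rw [List.ofFn_eq_insert _ i]
  simp

lemma List.take_succ_ofFn {α : Type*} {n : ℕ} (x : Fin (n + 1) → α) (i : Fin (n + 1)) :
    (List.ofFn x).take (i + 1) = List.ofFn fun a : Fin (i + 1) => x ⟨a, by omega⟩ := by
  refine List.ext_getElem ?_ fun j h1 h2 => ?_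
  · simp only [List.length_take, List.length_ofFn]
    omega
  · simp only [List.getElem_take, List.getElem_ofFn]

lemma List.drop_succ_ofFn {α : Type*} {n : ℕ} (x : Fin (n + 1) → α) (i : Fin (n + 1)) :
    (List.ofFn x).drop (i + 1) =
      List.ofFn fun b : Fin (n - i) => x ⟨i + 1 + b, by omega⟩ := by
  refine List.ext_getElem ?_ fun j h1 h2 => ?_
  · simp only [List.length_drop, List.length_ofFn]
    omega
  · simp only [List.getElem_drop, List.getElem_ofFn]

section Anchor

variable {K : Type uK} {O : Type uO} {A : Type uA} {E : ℕ → Type uE}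
  [Field K] [CommRing O] [Algebra K O] [∀ n, AddCommGroup (E n)] [∀ n, Module O (E n)]
  [LieRing A] [Module O A] [LieRingModule A O] [LieRinehartRing O A]
  [LieAlgebra K A] [LieRinehartAlgebra K O A]

/-- The anchor of the Lie-Rinehart algebra composed with the augmentation. -/
def FreeResolution.anchor (K : Type uK) [Field K] [Algebra K O] [LieAlgebra K A]
    [LieRinehartAlgebra K O A] (R : FreeResolution O A E) : E 0 →ₗ[O] Derivation K O O :=
  (LieRinehartAlgebra.anchor K O A).toLinearMap' ∘ₗ R.aug

lemma FreeResolution.anchor_apply (R : FreeResolution O A E) (x : E 0) :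
    R.anchor K x = LieRinehartAlgebra.anchor K O A (R.aug x) := rfl

end Anchor

section Assembly

variable {K : Type uK} {O : Type uO} {A : Type uA} {E : ℕ → Type uE}
  [Field K] [∀ n, AddCommGroup (E n)] [∀ n, Module K (E n)]

/-- A multilinear function of words, restricted to words of a given length. -/
def WordMultilinear.toMultilinearMap {q : List (⨁ n, E n) → ⨁ n, E n} (h : WordMultilinear K q)
    (k : ℕ) : MultilinearMap K (fun _ : Fin (k + 1) => ⨁ n, E n) (⨁ n, E n) where
  toFun x := q (List.ofFn x)
  map_update_add' x i a b := by
    rw [List.ofFn_update, List.ofFn_update, List.ofFn_update, h.add]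
  map_update_smul' x i c a := by
    rw [List.ofFn_update, List.ofFn_update, h.smul]

lemma WordMultilinear.toMultilinearMap_apply {q : List (⨁ n, E n) → ⨁ n, E n}
    (h : WordMultilinear K q) {k : ℕ} (x : Fin (k + 1) → ⨁ n, E n) :
    h.toMultilinearMap k x = q (List.ofFn x) := rfl

lemma vals_ofFn {n : ℕ} (x : Fin n → Letter E) :
    vals (List.ofFn x) = List.ofFn fun i => (x i).val := List.map_ofFn

lemma List.ofFn_pair {α : Type*} (x y : α) :
    (List.ofFn (![x, y] : Fin (1 + 1) → α)) = [x, y] := rfl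

variable [CommRing O] [∀ n, Module O (E n)]
  [LieRing A] [Module O A] [LieRingModule A O] [LieRinehartRing O A]

variable [Algebra K O] [LieAlgebra K A] [LieRinehartAlgebra K O A] [∀ n, IsScalarTower K O (E n)]

/-- Brackets that satisfy all higher Jacobi identities form a Lie `∞`-algebroid. -/
def AlmostAlgebroid.toLieInftyAlgebroid {R : FreeResolution O A E}
    {q : List (⨁ n, E n) → ⨁ n, E n} (h : AlmostAlgebroid K R q)
    (hJ : ∀ w, jacobiator q w = 0) : LieInftyAlgebroid K O E where
  projective n :=
    have := R.free n
    inferInstance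
  bracket k := h.multilinear.toMultilinearMap k
  bracket_perm k deg x hx σ := by
    have := h.symm.perm Letter.deg (fun i => (⟨deg i, x i, hx i⟩ : Letter E)) σ
    simp only [vals_ofFn] at this
    exact this
  bracket_degree k deg x hx := by
    have := h.homog (List.ofFn fun i => ⟨deg i, x i, hx i⟩)
    rwa [wordDegree_ofFn, vals_ofFn] at this
  anchor := R.anchor K
  jacobi n deg x hx := by
    have := hJ (List.ofFn fun i => ⟨deg i, x i, hx i⟩)
    -- The term `p = 0`, with an empty inner bracket, is split off. It vanishes because `q [] = 0`,
    -- and the index shift gives inner arity `i + 1`.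
    rw [jacobiator, unshuffleSum_ofFn, Finset.sum_range_succ', Finset.sum_range] at this
    rw [← this]
    conv_lhs => rw [← add_zero (Finset.sum _ _)]
    refine congrArg₂ (· + ·) (Finset.sum_congr rfl fun i _ =>
      Finset.sum_congr rfl fun σ _ => ?_) (Eq.symm (Finset.sum_eq_zero fun σ _ => ?_))
    · rw [List.take_succ_ofFn, List.drop_succ_ofFn, vals_ofFn, vals_ofFn,
        h.multilinear.toMultilinearMap_apply, List.ofFn_cons, h.multilinear.toMultilinearMap_apply]
    · rw [List.take_zero, vals_nil, h.nil, h.zero_head, smul_zero]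
  bracket_smul k hk x i f := by
    rw [h.multilinear.toMultilinearMap_apply, h.multilinear.toMultilinearMap_apply,
      List.ofFn_update, h.smul_of_length, ← List.ofFn_eq_insert]
    simp only [List.length_take, List.length_drop, List.length_ofFn]
    omega
  leibniz := h.leibniz
  anchor_unary z := by
    rw [R.anchor_apply, ← R.totalAug_apply, h.multilinear.toMultilinearMap_apply,
      h.aug_eq_zero _ (by simp)]
    exact (R.anchor K).map_zero ▸ map_zero (LieRinehartAlgebra.anchor K O A).toLinearMap'
  anchor_binary x y := by
    rw [R.anchor_apply, ← R.totalAug_apply, h.multilinear.toMultilinearMap_apply, List.ofFn_pair,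
      h.aug_binary, R.totalAug_apply, R.totalAug_apply, DirectSum.of_eq_same,
      DirectSum.of_eq_same]
    exact (LieRinehartAlgebra.anchor K O A).toLieHom.map_lie _ _

lemma AlmostAlgebroid.diff_toLieInftyAlgebroid {R : FreeResolution O A E}
    {q : List (⨁ n, E n) → ⨁ n, E n} (h : AlmostAlgebroid K R q)
    (hJ : ∀ w, jacobiator q w = 0) (n : ℕ) : (h.toLieInftyAlgebroid hJ).diff n = R.d n := by
  ext x
  change q [DirectSum.of E (n + 1) x] n = R.d n x
  rw [h.unary, R.totalDiff_apply, DirectSum.of_eq_same]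

lemma AlmostAlgebroid.covers_toLieInftyAlgebroid {R : FreeResolution O A E}
    {q : List (⨁ n, E n) → ⨁ n, E n} (h : AlmostAlgebroid K R q)
    (hJ : ∀ w, jacobiator q w = 0) : (h.toLieInftyAlgebroid hJ).Covers R.aug where
  map_binary x y := by
    have := h.aug_binary (DirectSum.of E 0 x) (DirectSum.of E 0 y)
    rwa [R.totalAug_apply, R.totalAug_apply, R.totalAug_apply, DirectSum.of_eq_same,
      DirectSum.of_eq_same] at this
  anchor_comp x := rfl
  surjective := R.aug_surjective

/-- The structure on a free resolution. -/
lemma FreeResolution.exists_lieInftyAlgebroid (K : Type uK) [Field K] [CharZero K] [Algebra K O]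
    [∀ n, Module K (E n)] [∀ n, IsScalarTower K O (E n)] [LieAlgebra K A]
    [LieRinehartAlgebra K O A] (R : FreeResolution O A E) :
    ∃ L : LieInftyAlgebroid K O E, (∀ n, L.diff n = R.d n) ∧ L.Covers R.aug := by
  obtain ⟨q, h, hJ⟩ := exists_homotopy_brackets K R
  exact ⟨h.toLieInftyAlgebroid hJ, h.diff_toLieInftyAlgebroid hJ, h.covers_toLieInftyAlgebroid hJ⟩

end Assembly

/-! ### Comparison of the basic Lie-Rinehart algebra with `A`. -/

namespace LieInftyAlgebroid

section

variable {K : Type uK} {O : Type uO} {A : Type uA} {E : ℕ → Type uE}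
  [Field K] [CharZero K] [CommRing O] [Algebra K O]
  [∀ n, AddCommGroup (E n)] [∀ n, Module O (E n)] [∀ n, Module K (E n)]
  [∀ n, IsScalarTower K O (E n)]
  [LieRing A] [Module O A] [LieRingModule A O] [LieRinehartRing O A]
  [LieAlgebra K A] [LieRinehartAlgebra K O A] {L : LieInftyAlgebroid K O E} {π : E 0 →ₗ[O] A}

/-- The map from the basic Lie-Rinehart algebra induced by a hook that vanishes on boundaries. -/
def Covers.basicHom (h : L.Covers π) (hπ : LinearMap.range (L.diff 0) ≤ LinearMap.ker π) :
    L.Basic →ₗ⁅AlgHom.id K O⁆ A where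
  toFun := (LinearMap.range (L.diff 0)).liftQ π hπ
  map_add' := map_add ((LinearMap.range (L.diff 0)).liftQ π hπ)
  map_smul' c a := by
    rw [← algebraMap_smul O c a, RingHom.id_apply, ← algebraMap_smul O c]
    exact map_smul ((LinearMap.range (L.diff 0)).liftQ π hπ) _ _
  map_lie' {a b} := by
    obtain ⟨x, rfl⟩ := Basic.proj_surjective L a
    obtain ⟨y, rfl⟩ := Basic.proj_surjective L b
    exact h.map_binary x y
  map_smul_apply' f a := map_smul ((LinearMap.range (L.diff 0)).liftQ π hπ) f a
  apply_lie' f a := by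
    obtain ⟨x, rfl⟩ := Basic.proj_surjective L a
    exact (DFunLike.congr_fun (h.anchor_comp x) f).symm

lemma Covers.basicHom_bijective (h : L.Covers π)
    (hπ : LinearMap.range (L.diff 0) = LinearMap.ker π) :
    Function.Bijective (h.basicHom hπ.le) := by
  refine ⟨?_, fun a => ?_⟩
  · have := LinearMap.ker_eq_bot.1 (Submodule.ker_liftQ_eq_bot _ π hπ.le hπ.ge)
    exact this
  · obtain ⟨x, rfl⟩ := h.surjective a
    exact ⟨Basic.proj L x, rfl⟩

end

end LieInftyAlgebroid

/-! ### The canonical free resolution. -/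

section Existence

/-- The iterated syzygies of a module with respect to the canonical free covers. -/
noncomputable def canonicalSyzygy (O : Type uO) [CommRing O] (M : ModuleCat.{max uO uA} O) :
    ℕ → ModuleCat.{max uO uA} O
  | 0 => M
  | n + 1 => ModuleCat.of O (LinearMap.ker
      (Finsupp.linearCombination O (id : canonicalSyzygy O M n → canonicalSyzygy O M n)))

variable (O : Type uO) (A : Type uA) [CommRing O] [AddCommGroup A] [Module O A]

/-- The terms of the canonical free resolution. -/
abbrev canonicalTerm (n : ℕ) : Type (max uO uA) :=
  canonicalSyzygy.{uO, uA} O (ModuleCat.of O (ULift.{uO} A)) n →₀ O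

/-- The canonical free cover of a syzygy. -/
noncomputable def canonicalCover (n : ℕ) :
    canonicalTerm O A n →ₗ[O] canonicalSyzygy.{uO, uA} O (ModuleCat.of O (ULift.{uO} A)) n :=
  Finsupp.linearCombination O id

lemma canonicalCover_surjective (n : ℕ) : Function.Surjective (canonicalCover O A n) :=
  Finsupp.linearCombination_id_surjective O _

/-- The inclusion of a syzygy. -/
noncomputable def canonicalInclusion (n : ℕ) :
    canonicalSyzygy.{uO, uA} O (ModuleCat.of O (ULift.{uO} A)) (n + 1) →ₗ[O]
      canonicalTerm O A n :=
  (LinearMap.ker (canonicalCover O A n)).subtype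

/-- The next cover is onto the kernel of the present one, so composing it with the inclusion gives
exactly that kernel as image. -/
lemma exact_canonical (n : ℕ) :
    Function.Exact (canonicalInclusion O A n ∘ₗ canonicalCover O A (n + 1))
      (canonicalCover O A n) := by
  rw [LinearMap.exact_iff, LinearMap.range_comp_of_range_eq_top _
    (LinearMap.range_eq_top.2 (canonicalCover_surjective O A (n + 1)))]
  exact (Submodule.range_subtype _).symm

/-- The canonical free resolution of a module. -/
noncomputable def canonicalResolution : FreeResolution O A (canonicalTerm O A) where
  free n := inferInstance
  d n := canonicalInclusion O A n ∘ₗ canonicalCover O A (n + 1)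
  aug := (ULift.moduleEquiv : ULift.{uO} A ≃ₗ[O] A).toLinearMap ∘ₗ canonicalCover O A 0
  exact_d n := by
    have h := exact_canonical O A (n + 1)
    exact h.comp_injective (canonicalInclusion O A n) (Submodule.subtype_injective _) (map_zero _)
  exact_aug := (exact_canonical O A 0).comp_injective _
    (ULift.moduleEquiv : ULift.{uO} A ≃ₗ[O] A).injective (map_zero _)
  aug_surjective := (ULift.moduleEquiv : ULift.{uO} A ≃ₗ[O] A).surjective.comp
    (canonicalCover_surjective O A 0)

end Existence

theorem mainTheorem1 {K : Type uK} {O : Type uO} {A : Type uA}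
    [Field K] [CharZero K] [CommRing O] [Algebra K O]
    [LieRing A] [Module O A] [LieRingModule A O] [LieRinehartRing O A]
    [LieAlgebra K A] [LieRinehartAlgebra K O A] :
    (∀ (E : ℕ → Type uE) [∀ n, AddCommGroup (E n)] [∀ n, Module O (E n)]
        [∀ n, Module K (E n)] [∀ n, IsScalarTower K O (E n)]
        (R : FreeResolution O A E),
      ∃ L : LieInftyAlgebroid K O E, (∀ n, L.diff n = R.d n) ∧ L.Covers R.aug) ∧
    (∃ (E : ℕ → Type (max uO uA)) (_ : ∀ n, AddCommGroup (E n)) (_ : ∀ n, Module O (E n))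
        (_ : ∀ n, Module K (E n)) (_ : ∀ n, IsScalarTower K O (E n))
        (L : LieInftyAlgebroid K O E),
      L.IsAcyclic ∧ ∃ φ : L.Basic →ₗ⁅AlgHom.id K O⁆ A, Function.Bijective φ) := by
  refine ⟨fun E _ _ _ _ R => R.exists_lieInftyAlgebroid K, canonicalTerm O A,
    inferInstance, inferInstance, inferInstance, inferInstance, ?_⟩
  obtain ⟨L, hL, h⟩ := (canonicalResolution O A).exists_lieInftyAlgebroid K
  refine ⟨L, fun n => ?_, h.basicHom ?_, h.basicHom_bijective ?_⟩
  · rw [hL, hL]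
    exact (canonicalResolution O A).exact_d n
  -- Both goals reduce to exactness at `𝓔₋₁`: the kernel of the augmentation is the image of the
  -- differential.
  all_goals
    have := LinearMap.exact_iff.1 (canonicalResolution O A).exact_aug
    rw [hL, this]
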